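/- Theorem. Let $\alpha>1$, $R>0$ and $C$ be real constants. There is a constant $K>0$, depending only on $\alpha$, $R$ and $C$, such that for every $\varepsilon>0$ there is $g_0>0$, depending only on $\varepsilon$, $\alpha$, $R$ and $C$, with the following property. Let $\mathcal H$ be any complex Hilbert space, and let $H:\mathbb R\to\mathcal B(\mathcal H)$ be a $C^\infty$ (in operator norm) family of bounded self-adjoint operators such that $\dot H$ is supported in $[0,1]$ and $$\Big\|\frac{d^kH}{ds^k}(s)\Big\|\le C\,R^k\,k^{\alpha k}\qquad\text{for all } k\ge 1 \text{ and } s\in[0,1]$$ (that is, $H$ is a switching family in the Gevrey class $G^\alpha$ with constants $R$ and $C$). Let $E:[0,1]\to\mathbb R$ be continuous, let $E(s)$ be an eigenvalue of $H(s)$ for each $s\in[0,1]$, of arbitrary, possibly infinite, multiplicity, and let $P(s)$ be the orthogonal projection onto the eigenspace $\ker(H(s)-E(s))$. Let $0<g<g_0$ be such that for every $s\in[0,1]$ the gap $g(s)=\operatorname{dist}\big(E(s),\sigma(H(s))\setminus\{E(s)\}\big)$ is at least $g$; for instance, $g=\min_{s\in[0,1]}g(s)$. Let $$\tau\ \ge\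 K\,g^{-2}\,|\ln g|^{6\alpha},$$ and let $\psi_\tau$ be the solution on $[0,1]$ of $$i\,\dot\psi_\tau(s)=\tau\,H(s)\,\psi_\tau(s),\qquad \psi_\tau(0)=\psi_I,$$ where $\psi_I\in\operatorname{Ran}P(0)$ and $\|\psi_I\|=1$. Then $$\operatorname{dist}\big(\psi_\tau(s),\operatorname{Ran}P(s)\big)<\varepsilon\qquad\text{for all } s\in[0,1].$$ In other words, the adiabatic error is $o(1)$ as $g\to0$, uniformly in $s\in[0,1]$, in such $\tau$, and in all such families with the given constants. -/

import Mathlib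

open Set
open scoped ContDiff ENNReal

noncomputable section

namespace SwitchingAdiabatic

variable {𝓗 : Type*} [NormedAddCommGroup 𝓗] [InnerProductSpace ℂ 𝓗]

/-- The orthogonal projection of a Hilbert space onto the kernel of `A - E`, that is, onto the
eigenspace of the bounded operator `A` for the real number `E`. -/
def eigenprojector [CompleteSpace 𝓗] (A : 𝓗 →L[ℂ] 𝓗) (E : ℝ) : 𝓗 →L[ℂ] 𝓗 :=
  (A - (E : ℂ) • ContinuousLinearMap.id ℂ 𝓗).ker.starProjection

/-- The distance from `E` to the rest of the spectrum of `A`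
(it is `⊤` if `A` has no other spectrum). -/
def spectralGap (A : 𝓗 →L[ℂ] 𝓗) (E : ℝ) : ℝ≥0∞ :=
  Metric.infEDist (E : ℂ) (spectrum ℂ A \ {(E : ℂ)})

/-- A smooth family of bounded self-adjoint operators, indexed by the rescaled time `s : ℝ`,
whose derivative is supported in `[0, 1]`. -/
structure IsSwitchingFamily [CompleteSpace 𝓗] (H : ℝ → 𝓗 →L[ℂ] 𝓗) : Prop where
  contDiff : ContDiff ℝ ∞ H
  selfAdjoint : ∀ s, IsSelfAdjoint (H s)
  support_deriv : tsupport (deriv H) ⊆ Icc 0 1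

/-- The Gevrey bounds of order `α` with constants `R` and `C` for the derivatives of `H` of
order `k ≥ 1` on `[0, 1]`. -/
def GevreyBound (α R C : ℝ) (H : ℝ → 𝓗 →L[ℂ] 𝓗) : Prop :=
  ∀ k : ℕ, 1 ≤ k → ∀ s ∈ Icc (0 : ℝ) 1,
    ‖iteratedDeriv k H s‖ ≤ C * R ^ k * (k : ℝ) ^ (α * k)

/-- On `[0, 1]`, `E` is a continuous choice of an eigenvalue `E s` of `H s`, and the gap between
`E s` and the rest of the spectrum of `H s` is at least `g`. -/
structure HasGappedEigenvalue (H : ℝ → 𝓗 →L[ℂ] 𝓗) (E : ℝ → ℝ) (g : ℝ) : Prop where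
  continuousOn : ContinuousOn E (Icc 0 1)
  hasEigenvalue : ∀ s ∈ Icc (0 : ℝ) 1,
    Module.End.HasEigenvalue (H s : 𝓗 →ₗ[ℂ] 𝓗) (E s : ℂ)
  gap : ∀ s ∈ Icc (0 : ℝ) 1, ENNReal.ofReal g ≤ spectralGap (H s) (E s)

/-- `ψ` solves the Schrödinger equation `i ψ' = τ H ψ` on `[0, 1]`. -/
def IsSchrodingerSolution (H : ℝ → 𝓗 →L[ℂ] 𝓗) (τ : ℝ) (ψ : ℝ → 𝓗) : Prop :=
  ∀ s ∈ Icc (0 : ℝ) 1,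
    HasDerivWithinAt ψ (-(Complex.I * (τ : ℂ)) • H s (ψ s)) (Icc 0 1) s

end SwitchingAdiabatic

end

/-!
The proof replaces the spectral subspace `Ran P(s)` by a nearby subspace that the evolution
preserves almost exactly, the graph over `Ran P(s)` of an operator `K(s)` mapping `Ran P` to
`Ran (1 - P)`. The graph is invariant exactly when `K` solves the Riccati equation
`[H, K] = (i / τ) (1 - P) (P' + K' + K P' K) P`; this is `IsGappedFamily.hasDerivAt_proj_add`, which
also identifies the defect when the equation only holds approximately.

The Riccati equation is solved by iteration from `K = 0`. Inverting the commutator costs a factor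
`1 / g`, and each iteration uses up one derivative. To keep track of the derivatives,
`jetNorm w N f s` is the sum of `w k ‖f⁽ᵏ⁾(s)‖` over `k ≤ N` with the Gevrey weights
`w k = ρᵏ / (k!)^α`. As `α ≥ 1`, this norm is submultiplicative; a derivative costs at most
`d = N^α / ρ` if the order is lowered by one; and for a switching family the radius `ρ` can be taken
proportional to `g`. Then the iteration contracts with ratio of order `d / (g τ) ~ N^α / (g² τ)`
(`IsGappedFamily.jetNorm_adiabaticGraph_le`), and after `N ≈ |ln g|` steps the defect is of order
`d θ^N`, where `θ` is small under the hypothesis on `τ`: it beats the factor `1 / g` in `d`.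

Two points make the jets manageable. The bound on the inverse of the commutator at a point `s`
(`IsGappedFamily.jetNorm_le_of_commutator_eq`) compares `H` and `P` with their values at `s`, so that
`E` and the reduced resolvent are never differentiated quantitatively; and since `P'` itself solves a
commutator equation, its jets are bounded by induction on the order. Smoothness of `P` is obtained
from continuity of `E` by bootstrapping `P' = -(P H' S + S H' P)`, with `S` the reduced resolvent,
which the continuous functional calculus provides.

Finally, for a solution `ψ` and its orthogonal projection `y` to the graph, the derivative of
`‖ψ - y‖²` only involves the defect of the Riccati equation (`norm_sub_projection_le`). The graph is
within `O(θ)` of `Ran P(s)`, and it equals `Ran P(0)` at `s = 0` because `H` is constant before.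
-/

/-! ### Weighted norms of jets -/

section Jets

/-- A submultiplicative sequence of weights for the derivatives of a function: with such weights
the Leibniz rule makes the weighted norm of a jet submultiplicative. -/
structure IsJetWeight (w : ℕ → ℝ) : Prop where
  nonneg : ∀ k, 0 ≤ w k
  zero : w 0 = 1
  choose_mul_le : ∀ i j, ((i + j).choose i : ℝ) * w (i + j) ≤ w i * w j

/-- The weighted norm of the jet of order `N` of `f` at the point `s`, that is, the sum of
`w k * ‖f⁽ᵏ⁾(s)‖` over `k ≤ N`. -/
noncomputable def jetNorm {F : Type*} [NormedAddCommGroup F] [NormedSpace ℝ F]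
    (w : ℕ → ℝ) (N : ℕ) (f : ℝ → F) (s : ℝ) : ℝ :=
  ∑ k ∈ Finset.range (N + 1), w k * ‖iteratedDeriv k f s‖

variable {w : ℕ → ℝ} {N : ℕ} {s : ℝ}

section Space

variable {F : Type*} [NormedAddCommGroup F] [NormedSpace ℝ F] {f g : ℝ → F}

theorem ContDiff.contDiffAt_natCast (hf : ContDiff ℝ ∞ f) (n : ℕ) (s : ℝ) :
    ContDiffAt ℝ n f s :=
  (hf.of_le (by exact_mod_cast le_top)).contDiffAt

theorem jetNorm_nonneg (hw : IsJetWeight w) (N : ℕ) (f : ℝ → F) (s : ℝ) : 0 ≤ jetNorm w N f s :=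
  Finset.sum_nonneg fun k _ => mul_nonneg (hw.nonneg k) (norm_nonneg _)

theorem jetNorm_mono (hw : IsJetWeight w) {M : ℕ} (h : N ≤ M) (f : ℝ → F) (s : ℝ) :
    jetNorm w N f s ≤ jetNorm w M f s :=
  Finset.sum_le_sum_of_subset_of_nonneg (Finset.range_mono (by omega))
    fun k _ _ => mul_nonneg (hw.nonneg k) (norm_nonneg _)

theorem jetNorm_order_zero (hw : IsJetWeight w) (f : ℝ → F) (s : ℝ) :
    jetNorm w 0 f s = ‖f s‖ := by
  simp [jetNorm, hw.zero]

theorem jetNorm_add_le (hw : IsJetWeight w) (hf : ContDiff ℝ ∞ f) (hg : ContDiff ℝ ∞ g) :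
    jetNorm w N (fun t => f t + g t) s ≤ jetNorm w N f s + jetNorm w N g s := by
  rw [jetNorm, jetNorm, jetNorm, ← Finset.sum_add_distrib]
  refine Finset.sum_le_sum fun k _ => ?_
  have h : iteratedDeriv k (fun t => f t + g t) s = iteratedDeriv k f s + iteratedDeriv k g s :=
    iteratedDeriv_add (hf.contDiffAt_natCast k s) (hg.contDiffAt_natCast k s)
  rw [h, ← mul_add]
  exact mul_le_mul_of_nonneg_left (norm_add_le _ _) (hw.nonneg k)

theorem jetNorm_sub_le (hw : IsJetWeight w) (hf : ContDiff ℝ ∞ f) (hg : ContDiff ℝ ∞ g) :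
    jetNorm w N (fun t => f t - g t) s ≤ jetNorm w N f s + jetNorm w N g s := by
  rw [jetNorm, jetNorm, jetNorm, ← Finset.sum_add_distrib]
  refine Finset.sum_le_sum fun k _ => ?_
  have h : iteratedDeriv k (fun t => f t - g t) s = iteratedDeriv k f s - iteratedDeriv k g s :=
    iteratedDeriv_sub (hf.contDiffAt_natCast k s) (hg.contDiffAt_natCast k s)
  rw [h, ← mul_add]
  exact mul_le_mul_of_nonneg_left (norm_sub_le _ _) (hw.nonneg k)

theorem jetNorm_neg (f : ℝ → F) (s : ℝ) :
    jetNorm w N (fun t => -f t) s = jetNorm w N f s := by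
  refine Finset.sum_congr rfl fun k _ => ?_
  have h : iteratedDeriv k (fun t => -f t) s = -iteratedDeriv k f s := iteratedDeriv_neg k f s
  rw [h, norm_neg]

theorem jetNorm_const (hw : IsJetWeight w) (a : F) (s : ℝ) :
    jetNorm w N (fun _ => a) s = ‖a‖ := by
  rw [jetNorm, Finset.sum_eq_single 0]
  · simp [hw.zero]
  · intro k _ hk
    simp [iteratedDeriv_const, hk]
  · simp

theorem jetNorm_comp_linearIsometry {G : Type*} [NormedAddCommGroup G] [NormedSpace ℝ G]
    (L : F →ₗᵢ[ℝ] G) (hf : ContDiff ℝ ∞ f) :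
    jetNorm w N (fun t => L (f t)) s = jetNorm w N f s := by
  refine Finset.sum_congr rfl fun k _ => ?_
  rw [← norm_iteratedFDeriv_eq_norm_iteratedDeriv, ← norm_iteratedFDeriv_eq_norm_iteratedDeriv,
    ← L.norm_iteratedFDeriv_comp_left (hf.contDiffAt_natCast k s) le_rfl]
  rfl

theorem jetNorm_deriv_le (hw : IsJetWeight w) {d : ℝ} (hd : ∀ k ≤ N, w k ≤ d * w (k + 1))
    (hd0 : 0 ≤ d) (f : ℝ → F) (s : ℝ) :
    jetNorm w N (deriv f) s ≤ d * jetNorm w (N + 1) f s := by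
  have h : jetNorm w N (deriv f) s
      ≤ ∑ k ∈ Finset.range (N + 1), d * (w (k + 1) * ‖iteratedDeriv (k + 1) f s‖) := by
    refine Finset.sum_le_sum fun k hk => ?_
    rw [iteratedDeriv_succ', ← mul_assoc]
    exact mul_le_mul_of_nonneg_right (hd k (Nat.lt_succ_iff.1 (Finset.mem_range.1 hk)))
      (norm_nonneg _)
  refine h.trans ?_
  rw [← Finset.mul_sum, jetNorm, Finset.sum_range_succ' _ (N + 1)]
  exact mul_le_mul_of_nonneg_left
    (le_add_of_nonneg_right (mul_nonneg (hw.nonneg 0) (norm_nonneg _))) hd0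

/-- The jet of `f - f s` at `s` has no term of order zero, hence is controlled by `f'`. -/
theorem jetNorm_sub_const_le {ρ : ℝ} (hρ : ∀ k, w (k + 1) ≤ ρ * w k)
    (f : ℝ → F) (s : ℝ) (N : ℕ) :
    jetNorm w (N + 1) (fun t => f t - f s) s ≤ ρ * jetNorm w N (deriv f) s := by
  rw [jetNorm, Finset.sum_range_succ' _ (N + 1), jetNorm, Finset.mul_sum]
  simp only [iteratedDeriv_zero, sub_self, norm_zero, mul_zero, add_zero]
  refine Finset.sum_le_sum fun k _ => ?_
  have h : deriv (fun t => f t - f s) = deriv f := by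
    funext t
    exact deriv_sub_const (f s)
  rw [iteratedDeriv_succ', h, ← mul_assoc]
  exact mul_le_mul_of_nonneg_right (hρ k) (norm_nonneg _)

theorem jetNorm_const_smul [NormedSpace ℂ F] [SMulCommClass ℝ ℂ F] (c : ℂ)
    (hf : ContDiff ℝ ∞ f) :
    jetNorm w N (fun t => c • f t) s = ‖c‖ * jetNorm w N f s := by
  rw [jetNorm, jetNorm, Finset.mul_sum]
  refine Finset.sum_congr rfl fun k _ => ?_
  have h : iteratedDeriv k (fun t => c • f t) s = c • iteratedDeriv k f s :=
    iteratedDeriv_const_smul (hf.contDiffAt_natCast k s) c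
  rw [h, norm_smul]
  ring

end Space

section Algebra

variable {A : Type*} [NormedRing A] [NormedAlgebra ℝ A] {f g : ℝ → A}

theorem jetNorm_mul_le (hw : IsJetWeight w) (hf : ContDiff ℝ ∞ f) (hg : ContDiff ℝ ∞ g) :
    jetNorm w N (fun t => f t * g t) s ≤ jetNorm w N f s * jetNorm w N g s := by
  set a : ℕ → ℝ := fun i => w i * ‖iteratedDeriv i f s‖
  set b : ℕ → ℝ := fun i => w i * ‖iteratedDeriv i g s‖
  have ha : ∀ i, 0 ≤ a i := fun i => mul_nonneg (hw.nonneg i) (norm_nonneg _)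
  have hb : ∀ i, 0 ≤ b i := fun i => mul_nonneg (hw.nonneg i) (norm_nonneg _)
  have h1 : ∀ n, w n * ‖iteratedDeriv n (fun t => f t * g t) s‖
      ≤ ∑ p ∈ Finset.HasAntidiagonal.antidiagonal n, a p.1 * b p.2 := by
    intro n
    have h := norm_iteratedFDeriv_mul_le hf hg s (n := n) (by exact_mod_cast le_top)
    simp only [norm_iteratedFDeriv_eq_norm_iteratedDeriv] at h
    refine (mul_le_mul_of_nonneg_left h (hw.nonneg n)).trans ?_
    rw [Finset.Nat.sum_antidiagonal_eq_sum_range_succ (fun i j => a i * b j), Finset.mul_sum]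
    refine Finset.sum_le_sum fun i hi => ?_
    obtain ⟨j, rfl⟩ := Nat.exists_eq_add_of_le (Nat.lt_succ_iff.1 (Finset.mem_range.1 hi))
    have := hw.choose_mul_le i j
    simp only [Nat.add_sub_cancel_left, a, b]
    calc _ = ((i + j).choose i * w (i + j)) * (‖iteratedDeriv i f s‖ * ‖iteratedDeriv j g s‖) := by
          ring
      _ ≤ (w i * w j) * (‖iteratedDeriv i f s‖ * ‖iteratedDeriv j g s‖) := by gcongr
      _ = _ := by ring
  calc jetNorm w N (fun t => f t * g t) s
      ≤ ∑ n ∈ Finset.range (N + 1), ∑ p ∈ Finset.HasAntidiagonal.antidiagonal n, a p.1 * b p.2 :=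
        Finset.sum_le_sum fun n _ => h1 n
    _ = ∑ p ∈ (Finset.range (N + 1)).sigma fun n => Finset.HasAntidiagonal.antidiagonal n,
          a p.2.1 * b p.2.2 := by rw [Finset.sum_sigma]
    _ = ∑ p ∈ ((Finset.range (N + 1)).sigma fun n => Finset.HasAntidiagonal.antidiagonal n).image
          (fun p => p.2), a p.1 * b p.2 := by
        rw [Finset.sum_image]
        rintro ⟨n, p⟩ hp ⟨m, q⟩ hq (h : p = q)
        simp only [Finset.coe_sigma, Set.mem_sigma_iff, Finset.mem_coe,
          Finset.HasAntidiagonal.mem_antidiagonal] at hp hq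
        obtain rfl := h
        obtain rfl : n = m := by rw [← hp.2, ← hq.2]
        rfl
    _ ≤ ∑ p ∈ Finset.range (N + 1) ×ˢ Finset.range (N + 1), a p.1 * b p.2 := by
        refine Finset.sum_le_sum_of_subset_of_nonneg ?_
          fun p _ _ => mul_nonneg (ha _) (hb _)
        intro p hp
        simp only [Finset.mem_image, Finset.mem_sigma, Finset.mem_range,
          Finset.HasAntidiagonal.mem_antidiagonal] at hp
        obtain ⟨⟨n, q⟩, ⟨h1, h2⟩, rfl⟩ := hp
        simp only [Finset.mem_product, Finset.mem_range]
        dsimp only at *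
        omega
    _ = jetNorm w N f s * jetNorm w N g s := by
        rw [jetNorm, jetNorm, Finset.sum_mul_sum, Finset.sum_product]

theorem jetNorm_const_mul_le (hw : IsJetWeight w) (a : A) (hf : ContDiff ℝ ∞ f) :
    jetNorm w N (fun t => a * f t) s ≤ ‖a‖ * jetNorm w N f s := by
  refine (jetNorm_mul_le hw contDiff_const hf).trans_eq ?_
  rw [jetNorm_const hw]

theorem jetNorm_mul_const_le (hw : IsJetWeight w) (a : A) (hf : ContDiff ℝ ∞ f) :
    jetNorm w N (fun t => f t * a) s ≤ jetNorm w N f s * ‖a‖ := by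
  refine (jetNorm_mul_le hw hf contDiff_const).trans_eq ?_
  rw [jetNorm_const hw]

end Algebra

end Jets

section GevreyWeight

/-- The weights `ρᵏ / (k!)^α` adapted to the Gevrey class of order `α`. -/
noncomputable def gevreyWeight (α ρ : ℝ) (k : ℕ) : ℝ := ρ ^ k / (k.factorial : ℝ) ^ α

variable {α ρ : ℝ}

theorem isJetWeight_gevreyWeight (hα : 1 ≤ α) (hρ : 0 < ρ) :
    IsJetWeight (gevreyWeight α ρ) where
  nonneg k := by unfold gevreyWeight; positivity
  zero := by simp [gevreyWeight]
  choose_mul_le i j := by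
    have hc : (1 : ℝ) ≤ (i + j).choose i := by
      exact_mod_cast Nat.choose_pos (Nat.le_add_right i j)
    have h : ((i + j).factorial : ℝ) = (i + j).choose i * (i.factorial * j.factorial) := by
      rw [← mul_assoc, Nat.choose_symm_add]
      exact_mod_cast (Nat.add_choose_mul_factorial_mul_factorial i j).symm
    have hi : (0 : ℝ) < i.factorial := by positivity
    have hj : (0 : ℝ) < j.factorial := by positivity
    unfold gevreyWeight
    rw [h, Real.mul_rpow (by positivity) (by positivity),
      Real.mul_rpow (by positivity) (by positivity), pow_add]
    have h1 : ((i + j).choose i : ℝ) ≤ ((i + j).choose i : ℝ) ^ α := Real.self_le_rpow_of_one_le hc hα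
    have h2 : (0 : ℝ) < ((i + j).choose i : ℝ) ^ α := by positivity
    rw [div_mul_div_comm, ← mul_div_assoc, div_le_div_iff₀ (by positivity) (by positivity)]
    calc _ = (ρ ^ i * ρ ^ j) * ((i.factorial : ℝ) ^ α * (j.factorial : ℝ) ^ α)
            * ((i + j).choose i : ℝ) := by ring
      _ ≤ (ρ ^ i * ρ ^ j) * ((i.factorial : ℝ) ^ α * (j.factorial : ℝ) ^ α)
            * ((i + j).choose i : ℝ) ^ α := by gcongr
      _ = _ := by ring

theorem gevreyWeight_eq_succ (hρ : 0 < ρ) (k : ℕ) :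
    gevreyWeight α ρ k = ((k + 1 : ℕ) : ℝ) ^ α / ρ * gevreyWeight α ρ (k + 1) := by
  unfold gevreyWeight
  rw [Nat.factorial_succ, Nat.cast_mul, Real.mul_rpow (by positivity) (by positivity), pow_succ]
  have h1 : (0 : ℝ) < ((k + 1 : ℕ) : ℝ) ^ α := by positivity
  have h2 : (0 : ℝ) < (k.factorial : ℝ) ^ α := by positivity
  field_simp

theorem gevreyWeight_le_succ (hα : 0 ≤ α) (hρ : 0 < ρ) {k M : ℕ} (h : k + 1 ≤ M) :
    gevreyWeight α ρ k ≤ (M : ℝ) ^ α / ρ * gevreyWeight α ρ (k + 1) := by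
  rw [gevreyWeight_eq_succ hρ]
  have : 0 ≤ gevreyWeight α ρ (k + 1) := by unfold gevreyWeight; positivity
  have h' : ((k + 1 : ℕ) : ℝ) ≤ M := by exact_mod_cast h
  gcongr

theorem gevreyWeight_succ_le (hα : 0 ≤ α) (hρ : 0 < ρ) (k : ℕ) :
    gevreyWeight α ρ (k + 1) ≤ ρ * gevreyWeight α ρ k := by
  rw [gevreyWeight_eq_succ hρ k]
  have : 0 ≤ gevreyWeight α ρ (k + 1) := by unfold gevreyWeight; positivity
  have h1 : (1 : ℝ) ≤ ((k + 1 : ℕ) : ℝ) ^ α :=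
    Real.one_le_rpow (by exact_mod_cast Nat.le_add_left 1 k) hα
  calc _ = 1 * gevreyWeight α ρ (k + 1) := (one_mul _).symm
    _ ≤ ((k + 1 : ℕ) : ℝ) ^ α * gevreyWeight α ρ (k + 1) := by gcongr
    _ = _ := by field_simp

theorem succ_pow_le_factorial (k : ℕ) :
    ((k + 1 : ℕ) : ℝ) ^ (k + 1) ≤ 3 * 6 ^ k * k.factorial := by
  have h := Real.pow_div_factorial_le_exp (x := ((k + 1 : ℕ) : ℝ)) (by positivity) (k + 1)
  rw [div_le_iff₀ (by positivity), Nat.factorial_succ] at h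
  have h2 : ((k + 1 : ℕ) : ℝ) ≤ 2 ^ k := by
    exact_mod_cast Nat.succ_le_of_lt k.lt_two_pow_self
  have h3 : Real.exp ((k + 1 : ℕ) : ℝ) ≤ 3 ^ (k + 1) := by
    rw [← mul_one ((k + 1 : ℕ) : ℝ), Real.exp_nat_mul]
    have := Real.exp_one_lt_d9
    gcongr
    linarith
  refine h.trans ?_
  rw [Nat.cast_mul]
  calc _ ≤ (3 : ℝ) ^ (k + 1) * (2 ^ k * k.factorial) := by gcongr
    _ = _ := by
      rw [show (6 : ℝ) = 2 * 3 by norm_num, mul_pow]; ring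

/-- Gevrey bounds on the derivatives of `f` bound the jets of `f'` uniformly in their order, as
soon as the radius `ρ` is small compared with `1 / R`. -/
theorem jetNorm_deriv_le_of_gevrey {F : Type*} [NormedAddCommGroup F] [NormedSpace ℝ F]
    {R C : ℝ} (hα : 0 ≤ α) (hρ : 0 < ρ) (hR : 0 < R) (hC : 0 ≤ C)
    (hρR : ρ * R * 6 ^ α ≤ 1 / 2) {f : ℝ → F} {s : ℝ}
    (hf : ∀ k : ℕ, 1 ≤ k → ‖iteratedDeriv k f s‖ ≤ C * R ^ k * (k : ℝ) ^ (α * k)) (N : ℕ) :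
    jetNorm (gevreyWeight α ρ) N (deriv f) s ≤ 2 * (C * R * 3 ^ α) := by
  have hx0 : 0 ≤ ρ * R * 6 ^ α := by positivity
  have key : ∀ k, gevreyWeight α ρ k * ‖iteratedDeriv k (deriv f) s‖
      ≤ C * R * 3 ^ α * (1 / 2) ^ k := by
    intro k
    have h1 := hf (k + 1) (by omega)
    rw [iteratedDeriv_succ'] at h1
    have h2 : ((k + 1 : ℕ) : ℝ) ^ (α * ((k + 1 : ℕ) : ℝ))
        ≤ 3 ^ α * (6 ^ α) ^ k * (k.factorial : ℝ) ^ α := by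
      rw [mul_comm α, Real.rpow_mul (by positivity), Real.rpow_natCast]
      refine (Real.rpow_le_rpow (by positivity) (succ_pow_le_factorial k) hα).trans_eq ?_
      rw [Real.mul_rpow (by positivity) (by positivity),
        Real.mul_rpow (by positivity) (by positivity), ← Real.rpow_natCast, ← Real.rpow_mul
        (by norm_num), mul_comm (k : ℝ), Real.rpow_mul (by norm_num), Real.rpow_natCast]
    have hfac : (0 : ℝ) < (k.factorial : ℝ) ^ α := by positivity
    calc _ ≤ gevreyWeight α ρ k * (C * R ^ (k + 1) *
              (3 ^ α * (6 ^ α) ^ k * (k.factorial : ℝ) ^ α)) := by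
            have : 0 ≤ gevreyWeight α ρ k := by unfold gevreyWeight; positivity
            gcongr
            exact h1.trans (by gcongr)
      _ = C * R * 3 ^ α * (ρ * R * 6 ^ α) ^ k := by
            unfold gevreyWeight
            rw [mul_pow, mul_pow, pow_succ]
            field_simp
      _ ≤ _ := by gcongr
  refine (Finset.sum_le_sum fun k _ => key k).trans ?_
  rw [← Finset.mul_sum, mul_comm 2]
  have h := Summable.sum_le_tsum (f := fun k => (1 / 2 : ℝ) ^ k) (Finset.range (N + 1))
    (fun _ _ => by positivity) summable_geometric_two
  rw [tsum_geometric_two] at h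
  gcongr

end GevreyWeight

/-! ### The spectral projection and the reduced resolvent -/

section Spectral

/-- The algebraic data of an eigenvalue `e` of `a` that is isolated from the rest of the spectrum
by a gap `g`: the spectral projection `p` and the reduced resolvent `r`, the inverse of `a - e` on
the range of `1 - p`. -/
structure IsIsolatedEigenvalue {A : Type*} [CStarAlgebra A] (a p r : A) (e g : ℝ) : Prop where
  mul_self : p * p = p
  selfAdjoint : star p = p
  norm_le : ‖p‖ ≤ 1
  norm_one_sub_le : ‖1 - p‖ ≤ 1
  op_mul : a * p = e • p
  mul_op : p * a = e • p
  resolvent_mul : r * (a - e • 1) = 1 - p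
  mul_resolvent : (a - e • 1) * r = 1 - p
  resolvent_mul_proj : r * p = 0
  proj_mul_resolvent : p * r = 0
  norm_resolvent_le : ‖r‖ ≤ 1 / g

variable {𝓗 : Type*} [NormedAddCommGroup 𝓗] [InnerProductSpace ℂ 𝓗] [CompleteSpace 𝓗]

open SwitchingAdiabatic in
/-- The reduced resolvent is the function `x ↦ (x - e)⁻¹` of `a`; the convention `0⁻¹ = 0`
gives it the value `0` on the eigenspace. -/
theorem exists_isIsolatedEigenvalue {a : 𝓗 →L[ℂ] 𝓗} {e g : ℝ} (ha : IsSelfAdjoint a)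
    (hg : 0 < g) (hgap : ENNReal.ofReal g ≤ spectralGap a e) :
    ∃ r, IsIsolatedEigenvalue a (eigenprojector a e) r e g := by
  have hfar : ∀ x ∈ spectrum ℂ a, x ≠ (e : ℂ) → g ≤ ‖x - e‖ := by
    intro x hx hne
    have h1 : ENNReal.ofReal g ≤ edist (e : ℂ) x :=
      hgap.trans (Metric.infEDist_le_edist_of_mem ⟨hx, hne⟩)
    rw [edist_dist, ENNReal.ofReal_le_ofReal_iff dist_nonneg, dist_comm, dist_eq_norm] at h1
    exact h1
  have hn : IsStarNormal a := ha.isStarNormal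
  have hf : ContinuousOn (fun x : ℂ => (x - e)⁻¹) (spectrum ℂ a) := by
    intro x hx
    by_cases hxe : x = e
    · refine (continuousWithinAt_const (b := (0 : ℂ))).congr_of_eventuallyEq ?_ (by simp [hxe])
      filter_upwards [self_mem_nhdsWithin,
        mem_nhdsWithin_of_mem_nhds (Metric.ball_mem_nhds x hg)] with y hy hyb
      have : y = e := by
        by_contra hne
        have h1 := hfar y hy hne
        rw [Metric.mem_ball, dist_eq_norm, hxe] at hyb
        linarith
      simp [this]
    · exact ((continuousAt_id.sub continuousAt_const).inv₀
        (sub_ne_zero.2 hxe)).continuousWithinAt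
  have hl : ContinuousOn (fun x : ℂ => x - e) (spectrum ℂ a) := by fun_prop
  set b : 𝓗 →L[ℂ] 𝓗 := a - (e : ℂ) • ContinuousLinearMap.id ℂ 𝓗 with hb
  set p := eigenprojector a e with hp
  have hbc : cfc (fun x : ℂ => x - e) a = b := by
    rw [cfc_sub (fun x : ℂ => x) (fun _ => (e : ℂ)) a, cfc_id' ℂ a, cfc_const (e : ℂ) a,
      Algebra.algebraMap_eq_smul_one]
    rfl
  set r := cfc (fun x : ℂ => (x - e)⁻¹) a with hr
  have hcomm : b * r = r * b := by
    rw [← hbc, hr, ← cfc_mul _ _ a hl hf, ← cfc_mul _ _ a hf hl]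
    simp only [mul_comm]
  have hfl : ContinuousOn (fun x : ℂ => (x - e)⁻¹ * (x - e)) (spectrum ℂ a) := hf.mul hl
  have hbrb : b * (r * b) = b := by
    rw [← hbc, hr, ← cfc_mul _ _ a hf hl, ← cfc_mul _ _ a hl hfl]
    congr 1
    funext x
    rw [← mul_assoc]
    exact mul_inv_mul_cancel _
  have hrrb : r * (r * b) = r := by
    rw [← hbc, hr, ← cfc_mul _ _ a hf hl, ← cfc_mul _ _ a hf hfl]
    congr 1
    funext x
    by_cases hx : x - (e : ℂ) = 0
    · simp [hx]
    · rw [inv_mul_cancel₀ hx, mul_one]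
  have hbp : b * p = 0 := by
    ext v
    exact (b.ker.starProjection_apply_mem v)
  have hsb : star b = b := by
    rw [hb, star_sub, ha.star_eq, star_smul]
    congr 1
    rw [show ContinuousLinearMap.id ℂ 𝓗 = 1 from rfl, star_one]
    simp
  have hsp : star p = p := isSelfAdjoint_starProjection b.ker
  have hpp : p * p = p := (Submodule.isIdempotentElem_starProjection b.ker)
  have hpb : p * b = 0 := by
    rw [← hsp, ← hsb, ← star_mul, hbp, star_zero]
  have hpq : p * (1 - r * b) = 1 - r * b := by
    ext v
    refine Submodule.starProjection_eq_self_iff.2 ?_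
    change (b * (1 - r * b)) v = 0
    rw [mul_sub, mul_one, hbrb, sub_self]
    rfl
  have hq : r * b = 1 - p := by
    rw [mul_sub, mul_one, ← hcomm, ← mul_assoc, hpb, zero_mul, sub_zero, hcomm] at hpq
    rw [hpq, sub_sub_cancel]
  have hbe : a - e • (1 : 𝓗 →L[ℂ] 𝓗) = b := by
    rw [hb]; rfl
  refine ⟨r, hpp, hsp, b.ker.starProjection_norm_le, ?_, ?_, ?_, ?_, ?_, ?_, ?_, ?_⟩
  · rw [show (1 : 𝓗 →L[ℂ] 𝓗) - p = (b.ker)ᗮ.starProjection from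
      (Submodule.starProjection_orthogonal' b.ker).symm]
    exact (b.ker)ᗮ.starProjection_norm_le
  · rw [← hbe, sub_mul, smul_mul_assoc, one_mul, sub_eq_zero] at hbp
    exact hbp
  · rw [← hbe, mul_sub, mul_smul_comm, mul_one, sub_eq_zero] at hpb
    exact hpb
  · rw [hbe, hq]
  · rw [hbe, hcomm, hq]
  · rw [hq, mul_sub, mul_one, sub_eq_self] at hrrb
    exact hrrb
  · have : r * b * r = r := by rw [mul_assoc, hcomm, hrrb]
    rw [hq, sub_mul, one_mul, sub_eq_self] at this
    exact this
  · refine norm_cfc_le (by positivity) fun x hx => ?_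
    by_cases hxe : x = e
    · simp only [hxe, sub_self, inv_zero, norm_zero]
      positivity
    · rw [norm_inv, one_div]
      exact inv_anti₀ hg (hfar x hx hxe)

open SwitchingAdiabatic in
theorem eigenprojector_ne_zero {a : 𝓗 →L[ℂ] 𝓗} {e : ℝ}
    (he : Module.End.HasEigenvalue (a : 𝓗 →ₗ[ℂ] 𝓗) (e : ℂ)) : eigenprojector a e ≠ 0 := by
  obtain ⟨v, hv⟩ := he.exists_hasEigenvector
  intro h
  have h1 : eigenprojector a e v = v := by
    refine Submodule.starProjection_eq_self_iff.2 ?_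
    change a v - (e : ℂ) • v = 0
    rw [sub_eq_zero]
    exact hv.apply_eq_smul
  rw [h] at h1
  exact hv.2 h1.symm

end Spectral

/-! ### Smoothness of the spectral data -/

section Smoothness

open Filter Topology

/-- A smooth family of elements of a C⋆-algebra with an isolated eigenvalue `E s`, the spectral
projection `P s`, the reduced resolvent `S s`, and a uniform gap `g`. Only continuity of `E` is
required, and none of `P` and `S`: their smoothness follows. -/
structure IsGappedFamily {A : Type*} [CStarAlgebra A] (H P S : ℝ → A) (E : ℝ → ℝ) (g : ℝ) :
    Prop where
  contDiff : ContDiff ℝ ∞ H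
  continuous : Continuous E
  pos : 0 < g
  isolated : ∀ s, IsIsolatedEigenvalue (H s) (P s) (S s) (E s) g
  ne_zero : ∀ s, P s ≠ 0

variable {A : Type*} [CStarAlgebra A]

namespace IsIsolatedEigenvalue

variable {a p r a₀ p₀ r₀ : A} {e e₀ g : ℝ}

theorem resolvent_add_proj_mul (h : IsIsolatedEigenvalue a p r e g) :
    (r + p) * (a - e • 1 + p) = 1 := by
  rw [add_mul, mul_add, mul_add, h.resolvent_mul, h.resolvent_mul_proj, h.mul_self, mul_sub,
    h.mul_op, mul_smul_comm, mul_one]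
  abel

theorem isUnit (h : IsIsolatedEigenvalue a p r e g) : IsUnit (a - e • 1 + p) := by
  refine ⟨⟨a - e • 1 + p, r + p, ?_, h.resolvent_add_proj_mul⟩, rfl⟩
  rw [add_mul, mul_add, mul_add, h.mul_resolvent, h.proj_mul_resolvent, h.mul_self, sub_mul,
    h.op_mul, smul_mul_assoc, one_mul]
  abel

theorem inverse_eq (h : IsIsolatedEigenvalue a p r e g) :
    Ring.inverse (a - e • 1 + p) = r + p := by
  calc _ = (r + p) * (a - e • 1 + p) * Ring.inverse (a - e • 1 + p) := by
        rw [h.resolvent_add_proj_mul, one_mul]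
    _ = r + p := by rw [mul_assoc, Ring.mul_inverse_cancel _ h.isUnit, mul_one]

theorem proj_mul_compl (h : IsIsolatedEigenvalue a p r e g)
    (h₀ : IsIsolatedEigenvalue a₀ p₀ r₀ e₀ g) :
    p * (1 - p₀) = p * (a₀ - a) * r₀ + (e - e₀) • (p * r₀) := by
  rw [← h₀.mul_resolvent, ← mul_assoc, ← smul_mul_assoc, ← add_mul]
  congr 1
  rw [mul_sub, mul_sub, h.mul_op, sub_smul, mul_smul_comm, mul_one]
  abel

theorem compl_mul_proj (h : IsIsolatedEigenvalue a p r e g)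
    (h₀ : IsIsolatedEigenvalue a₀ p₀ r₀ e₀ g) :
    (1 - p) * p₀ = r * (a - a₀) * p₀ + (e₀ - e) • (r * p₀) := by
  rw [← h.resolvent_mul, mul_assoc, mul_assoc, ← mul_smul_comm, ← mul_add]
  congr 1
  rw [sub_mul, sub_mul, h₀.op_mul, sub_smul, smul_mul_assoc, one_mul]
  abel

theorem norm_sub_le (h : IsIsolatedEigenvalue a p r e g)
    (h₀ : IsIsolatedEigenvalue a₀ p₀ r₀ e₀ g) (hg : 0 < g) :
    ‖p - p₀‖ ≤ 2 * ((‖a - a₀‖ + |e - e₀|) * (1 / g)) := by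
  have hd : p - p₀ = p * (1 - p₀) - (1 - p) * p₀ := by noncomm_ring
  have hg' : 0 ≤ 1 / g := by positivity
  have b1 : ‖p * (1 - p₀)‖ ≤ (‖a - a₀‖ + |e - e₀|) * (1 / g) := by
    rw [h.proj_mul_compl h₀, add_mul]
    refine (norm_add_le _ _).trans (add_le_add ?_ ?_)
    · calc _ ≤ ‖p‖ * ‖a₀ - a‖ * ‖r₀‖ :=
            (norm_mul_le _ _).trans (mul_le_mul_of_nonneg_right (norm_mul_le _ _) (norm_nonneg _))
        _ ≤ 1 * ‖a₀ - a‖ * (1 / g) := by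
            gcongr
            exacts [h.norm_le, h₀.norm_resolvent_le]
        _ = _ := by rw [one_mul, norm_sub_rev]
    · rw [norm_smul, Real.norm_eq_abs]
      calc _ ≤ |e - e₀| * (‖p‖ * ‖r₀‖) := by gcongr; exact norm_mul_le _ _
        _ ≤ |e - e₀| * (1 * (1 / g)) := by
            gcongr
            exacts [h.norm_le, h₀.norm_resolvent_le]
        _ = _ := by rw [one_mul]
  have b2 : ‖(1 - p) * p₀‖ ≤ (‖a - a₀‖ + |e - e₀|) * (1 / g) := by
    rw [h.compl_mul_proj h₀, add_mul]
    refine (norm_add_le _ _).trans (add_le_add ?_ ?_)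
    · calc _ ≤ ‖r‖ * ‖a - a₀‖ * ‖p₀‖ :=
            (norm_mul_le _ _).trans (mul_le_mul_of_nonneg_right (norm_mul_le _ _) (norm_nonneg _))
        _ ≤ (1 / g) * ‖a - a₀‖ * 1 := by
            gcongr
            exacts [h.norm_resolvent_le, h₀.norm_le]
        _ = _ := by ring
    · rw [norm_smul, Real.norm_eq_abs, abs_sub_comm]
      calc _ ≤ |e - e₀| * (‖r‖ * ‖p₀‖) := by gcongr; exact norm_mul_le _ _
        _ ≤ |e - e₀| * ((1 / g) * 1) := by
            gcongr
            exacts [h.norm_resolvent_le, h₀.norm_le]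
        _ = _ := by rw [mul_one]
  rw [hd]
  refine (_root_.norm_sub_le _ _).trans ?_
  linarith

/-- A variant of `compl_mul_proj` in which the perturbation `a - a₀` is a factor of the whole
right-hand side. -/
theorem compl_mul_proj_eq_inverse_mul (h : IsIsolatedEigenvalue a p r e g)
    (h₀ : IsIsolatedEigenvalue a₀ p₀ r₀ e₀ g) (hu : IsUnit (a - e₀ • 1 + p)) :
    (1 - p) * p₀ = Ring.inverse (a - e₀ • 1 + p) * (1 - p) * (a - a₀) * p₀ := by
  have h1 : (a - e₀ • 1 + p) * ((1 - p) * p₀) = (1 - p) * (a - a₀) * p₀ := by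
    have e1 : (a - e₀ • 1 + p) * (1 - p) = (1 - p) * (a - e₀ • 1) := by
      simp only [mul_sub, sub_mul, add_mul, h.op_mul, h.mul_op, mul_one, one_mul, h.mul_self,
        smul_mul_assoc, mul_smul_comm, smul_sub]
      abel
    have e2 : (a - e₀ • 1) * p₀ = (a - a₀) * p₀ := by
      rw [sub_mul, sub_mul, h₀.op_mul, smul_mul_assoc, one_mul]
    rw [← mul_assoc, e1, mul_assoc, e2, mul_assoc]
  rw [mul_assoc, mul_assoc, ← mul_assoc (1 - p), ← h1, ← mul_assoc,
    Ring.inverse_mul_cancel _ hu, one_mul]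

/-- A variant of `proj_mul_compl` in which the perturbation `a₀ - a` is a factor of the whole
right-hand side. -/
theorem proj_mul_compl_eq_mul_inverse (h : IsIsolatedEigenvalue a p r e g)
    (h₀ : IsIsolatedEigenvalue a₀ p₀ r₀ e₀ g) (hu : IsUnit (a₀ - e • 1 + p₀)) :
    p * (1 - p₀) = p * (a₀ - a) * ((1 - p₀) * Ring.inverse (a₀ - e • 1 + p₀)) := by
  have h1 : p * (1 - p₀) * (a₀ - e • 1 + p₀) = p * (a₀ - a) * (1 - p₀) := by
    have e1 : (1 - p₀) * (a₀ - e • 1 + p₀) = (a₀ - e • 1) * (1 - p₀) := by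
      simp only [mul_sub, sub_mul, mul_add, h₀.op_mul, h₀.mul_op, mul_one, one_mul, h₀.mul_self,
        smul_mul_assoc, mul_smul_comm, smul_sub]
      abel
    have e2 : p * (a₀ - e • 1) = p * (a₀ - a) := by
      rw [mul_sub, mul_sub, h.mul_op, mul_smul_comm, mul_one]
    rw [mul_assoc, e1, ← mul_assoc, e2]
  rw [← mul_assoc, ← h1, mul_assoc, Ring.mul_inverse_cancel _ hu, mul_one]

end IsIsolatedEigenvalue

/-- A product rule in which the factors next to one that vanishes need only be continuous. -/
theorem HasDerivAt.mul_mul_of_eq_zero {F f G : ℝ → A} {f' : A} {s : ℝ} (hf : HasDerivAt f f' s)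
    (h0 : f s = 0) (hF : ContinuousAt F s) (hG : ContinuousAt G s) :
    HasDerivAt (fun t => F t * f t * G t) (F s * f' * G s) s := by
  rw [hasDerivAt_iff_tendsto_slope] at hf ⊢
  have h := ((hF.tendsto.mono_left nhdsWithin_le_nhds).mul hf).mul
    (hG.tendsto.mono_left nhdsWithin_le_nhds)
  refine h.congr fun t => ?_
  simp only [slope, vsub_eq_sub, h0, sub_zero, mul_zero, zero_mul, mul_smul_comm, smul_mul_assoc]

namespace IsGappedFamily

variable {H P S : ℝ → A} {E : ℝ → ℝ} {g : ℝ}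

theorem continuous_proj (h : IsGappedFamily H P S E g) : Continuous P := by
  rw [continuous_iff_continuousAt]
  intro s
  rw [ContinuousAt, tendsto_iff_norm_sub_tendsto_zero]
  have hc : Tendsto (fun t => 2 * ((‖H t - H s‖ + |E t - E s|) * (1 / g))) (𝓝 s) (𝓝 0) := by
    have : Continuous fun t => 2 * ((‖H t - H s‖ + |E t - E s|) * (1 / g)) := by
      have h1 := h.contDiff.continuous
      have h2 := h.continuous
      fun_prop
    have h3 := this.tendsto s
    simpa using h3
  exact squeeze_zero (fun _ => norm_nonneg _)
    (fun t => (h.isolated t).norm_sub_le (h.isolated s) h.pos) hc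

/-- Write `P t - P s = P t (1 - P s) - (1 - P t) P s`; in both terms `H t - H s` is a factor, and
the other factors are continuous in `t`. -/
theorem hasDerivAt_proj (h : IsGappedFamily H P S E g) (s : ℝ) :
    HasDerivAt P (-(P s * deriv H s * S s + S s * deriv H s * P s)) s := by
  have hH : HasDerivAt H (deriv H s) s :=
    (h.contDiff.differentiable (by simp)).differentiableAt.hasDerivAt
  have hHc := h.contDiff.continuous
  have hPc := h.continuous_proj
  have hEc := h.continuous
  have hs := h.isolated s
  obtain ⟨u, hu⟩ := hs.isUnit
  have c1 : ContinuousAt (fun t => H t - E s • 1 + P t) s := by fun_prop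
  have c2 : ContinuousAt (fun t => H s - E t • 1 + P s) s := by fun_prop
  have hinv : ContinuousAt Ring.inverse (H s - E s • 1 + P s) := by
    rw [← hu]
    exact NormedRing.inverse_continuousAt u
  have i1 : ContinuousAt (fun t => Ring.inverse (H t - E s • 1 + P t) * (1 - P t)) s :=
    (ContinuousAt.comp (f := fun t => H t - E s • 1 + P t) hinv c1).mul (by fun_prop)
  have i2 : ContinuousAt (fun t => (1 - P s) * Ring.inverse (H s - E t • 1 + P s)) s :=
    continuousAt_const.mul
      (ContinuousAt.comp (f := fun t => H s - E t • 1 + P s) hinv c2)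
  have u1 : ∀ᶠ t in 𝓝 s, IsUnit (H t - E s • 1 + P t) :=
    c1.eventually_mem (Units.isOpen.mem_nhds hs.isUnit)
  have u2 : ∀ᶠ t in 𝓝 s, IsUnit (H s - E t • 1 + P s) :=
    c2.eventually_mem (Units.isOpen.mem_nhds hs.isUnit)
  have d1 := (hH.sub_const (H s)).mul_mul_of_eq_zero (sub_self _) i1
    (continuousAt_const (y := P s))
  have d2 := (hH.const_sub (H s)).mul_mul_of_eq_zero (sub_self _) hPc.continuousAt i2
  have d := (d2.sub d1).const_add (P s)
  have e1 : (S s + P s) * (1 - P s) = S s := by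
    rw [add_mul, mul_sub, mul_sub, hs.mul_self, hs.resolvent_mul_proj]
    simp
  have e2 : (1 - P s) * (S s + P s) = S s := by
    rw [mul_add, sub_mul, sub_mul, hs.mul_self, hs.proj_mul_resolvent]
    simp
  rw [hs.inverse_eq, e1, e2] at d
  have hval : P s * -deriv H s * S s - S s * deriv H s * P s
      = -(P s * deriv H s * S s + S s * deriv H s * P s) := by noncomm_ring
  rw [hval] at d
  refine d.congr_of_eventuallyEq ?_
  filter_upwards [u1, u2] with t ht1 ht2
  have ht := h.isolated t
  simp only [Pi.sub_apply]
  rw [← ht.proj_mul_compl_eq_mul_inverse hs ht2, ← ht.compl_mul_proj_eq_inverse_mul hs ht1]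
  noncomm_ring

theorem deriv_proj (h : IsGappedFamily H P S E g) :
    deriv P = fun s => -(P s * deriv H s * S s + S s * deriv H s * P s) :=
  funext fun s => (h.hasDerivAt_proj s).deriv

/-- The eigenvalue is as smooth as the projection: apply to `H P = E P` a functional that does not
vanish on `P`. -/
theorem contDiff_eigenvalue (h : IsGappedFamily H P S E g) {n : ℕ} (hP : ContDiff ℝ n P) :
    ContDiff ℝ n E := by
  rw [contDiff_iff_contDiffAt]
  intro s
  obtain ⟨l, -, hl⟩ := exists_dual_vector ℝ (P s) (norm_ne_zero_iff.2 (h.ne_zero s))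
  have hls : l (P s) ≠ 0 := by
    rw [hl]
    exact_mod_cast norm_ne_zero_iff.2 (h.ne_zero s)
  have hH : ContDiff ℝ n H := h.contDiff.of_le (by exact_mod_cast le_top)
  have h1 : ContDiff ℝ n fun t => l (H t * P t) := l.contDiff.comp (hH.mul hP)
  have h2 : ContDiff ℝ n fun t => l (P t) := l.contDiff.comp hP
  refine (h1.contDiffAt.div h2.contDiffAt hls).congr_of_eventuallyEq ?_
  filter_upwards [h2.continuous.continuousAt.eventually_ne hls] with t ht
  rw [Pi.div_apply, (h.isolated t).op_mul, map_smul, smul_eq_mul, mul_div_cancel_right₀ _ ht]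

theorem contDiff_resolvent_of_proj (h : IsGappedFamily H P S E g) {n : ℕ}
    (hP : ContDiff ℝ n P) : ContDiff ℝ n S := by
  have hE := h.contDiff_eigenvalue hP
  have hH : ContDiff ℝ n H := h.contDiff.of_le (by exact_mod_cast le_top)
  have hS : S = fun t => Ring.inverse (H t - E t • 1 + P t) - P t := by
    funext t
    rw [(h.isolated t).inverse_eq, add_sub_cancel_right]
  rw [hS, contDiff_iff_contDiffAt]
  intro s
  obtain ⟨u, hu⟩ := (h.isolated s).isUnit
  have hi : ContDiffAt ℝ n Ring.inverse (H s - E s • 1 + P s) := by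
    rw [← hu]
    exact contDiffAt_ringInverse ℝ u
  have hc : ContDiff ℝ n fun t => H t - E t • 1 + P t :=
    (hH.sub (hE.smul contDiff_const)).add hP
  exact (ContDiffAt.comp s (f := fun t => H t - E t • 1 + P t) hi hc.contDiffAt).sub
    hP.contDiffAt

/-- By induction on the order: the derivative of `P` is a polynomial in `P`, `H'` and `S`, and `S`
is as smooth as `P`. -/
theorem contDiff_proj (h : IsGappedFamily H P S E g) : ContDiff ℝ ∞ P := by
  rw [contDiff_infty]
  intro n
  induction n with
  | zero => exact contDiff_zero.2 h.continuous_proj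
  | succ n ih =>
    have hS := h.contDiff_resolvent_of_proj ih
    have hH : ContDiff ℝ n (deriv H) :=
      (contDiff_infty_iff_deriv.1 h.contDiff).2.of_le (by exact_mod_cast le_top)
    rw [Nat.cast_add, Nat.cast_one, contDiff_succ_iff_deriv]
    refine ⟨fun s => (h.hasDerivAt_proj s).differentiableAt, by simp, ?_⟩
    rw [h.deriv_proj]
    exact (((ih.mul hH).mul hS).add ((hS.mul hH).mul ih)).neg

theorem contDiff_resolvent (h : IsGappedFamily H P S E g) : ContDiff ℝ ∞ S :=
  contDiff_infty.2 fun n => h.contDiff_resolvent_of_proj (contDiff_infty.1 h.contDiff_proj n)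

end IsGappedFamily

end Smoothness

/-! ### Jets of the spectral projection -/

section SpectralJets

variable {A : Type*} [CStarAlgebra A] {w : ℕ → ℝ} {N : ℕ} {s : ℝ}

theorem ContDiff.deriv_infty {F : Type*} [NormedAddCommGroup F] [NormedSpace ℝ F] {f : ℝ → F}
    (hf : ContDiff ℝ ∞ f) : ContDiff ℝ ∞ (deriv f) :=
  (contDiff_infty_iff_deriv.1 hf).2

theorem jetNorm_star {f : ℝ → A} (hf : ContDiff ℝ ∞ f) :
    jetNorm w N (fun t => star (f t)) s = jetNorm w N f s :=
  jetNorm_comp_linearIsometry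
    ({ toLinearMap := ((starL' ℝ : A ≃L[ℝ] A) : A →ₗ[ℝ] A), norm_map' := norm_star } :
      A →ₗᵢ[ℝ] A) hf

/-- The shape of the solutions of Sylvester's equation that occur here: `X` maps the range of `P`
to that of `1 - P` and vanishes on the latter. -/
structure IsOffDiagonal (P X : ℝ → A) : Prop where
  proj_mul : ∀ t, P t * X t = 0
  mul_proj : ∀ t, X t * P t = X t

namespace IsGappedFamily

variable {H P S X Y : ℝ → A} {E : ℝ → ℝ} {g : ℝ}

/-- The solution of `[H, X] = Y` is bounded by `Y / g` in the jet norms, as long as the jets of `H`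
and `P` at `s` are nearly constant. The point is that `H` and `P` may be replaced by their values
at `s`, where the equation is solved by the reduced resolvent; neither `E` nor the resolvent has to
be differentiated. -/
theorem jetNorm_le_of_commutator_eq (h : IsGappedFamily H P S E g) (hw : IsJetWeight w)
    (hX : ContDiff ℝ ∞ X) (hY : ContDiff ℝ ∞ Y) (hPX : IsOffDiagonal P X)
    (hXY : ∀ t, H t * X t - X t * H t = Y t)
    (hH : jetNorm w N (fun t => H t - H s) s ≤ g / 8)
    (hP : jetNorm w N (fun t => P t - P s) s ≤ 1 / 8) :
    jetNorm w N X s ≤ 2 / g * jetNorm w N Y s := by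
  have hg := h.pos
  have hs := h.isolated s
  have cH : ContDiff ℝ ∞ fun t => H t - H s := h.contDiff.sub contDiff_const
  have cP : ContDiff ℝ ∞ fun t => P t - P s := h.contDiff_proj.sub contDiff_const
  have c1 : ContDiff ℝ ∞ fun t => Y t - (H t - H s) * X t := hY.sub (cH.mul hX)
  have c2 : ContDiff ℝ ∞ fun t => Y t - (H t - H s) * X t + X t * (H t - H s) :=
    c1.add (hX.mul cH)
  have c3 : ContDiff ℝ ∞ fun t => S s * (Y t - (H t - H s) * X t + X t * (H t - H s)) :=
    contDiff_const.mul c2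
  have c4 : ContDiff ℝ ∞ fun t =>
      S s * (Y t - (H t - H s) * X t + X t * (H t - H s)) * P s := c3.mul contDiff_const
  have c5 : ContDiff ℝ ∞ fun t => (P t - P s) * X t := cP.mul hX
  have c6 : ContDiff ℝ ∞ fun t => X t * (P t - P s) := hX.mul cP
  have c7 : ContDiff ℝ ∞ fun t => (1 - P s) * (X t * (P t - P s)) := contDiff_const.mul c6
  have hid : X = fun t => S s * (Y t - (H t - H s) * X t + X t * (H t - H s)) * P s
      - (P t - P s) * X t + (1 - P s) * (X t * (P t - P s)) := by
    funext t
    have e1 : S s * (Y t - (H t - H s) * X t + X t * (H t - H s)) * P s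
        = (1 - P s) * X t * P s := by
      have : Y t - (H t - H s) * X t + X t * (H t - H s) = H s * X t - X t * H s := by
        rw [← hXY]; noncomm_ring
      rw [this, ← hs.resolvent_mul, mul_assoc, sub_mul (H s * X t), mul_assoc (X t), hs.op_mul]
      simp only [mul_sub, sub_mul, mul_smul_comm, smul_mul_assoc, mul_one, mul_assoc]
    rw [e1, sub_mul (P t), hPX.proj_mul, mul_sub (X t), hPX.mul_proj]
    noncomm_ring
  set x := jetNorm w N X s
  set y := jetNorm w N Y s
  have hx0 : 0 ≤ x := jetNorm_nonneg hw N X s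
  have hy0 : 0 ≤ y := jetNorm_nonneg hw N Y s
  have b1 : jetNorm w N (fun t => Y t - (H t - H s) * X t + X t * (H t - H s)) s
      ≤ y + g / 8 * x + x * (g / 8) := by
    refine (jetNorm_add_le hw c1 (hX.mul cH)).trans (add_le_add ?_ ?_)
    · refine (jetNorm_sub_le hw hY (cH.mul hX)).trans (add_le_add le_rfl ?_)
      exact (jetNorm_mul_le hw cH hX).trans (by gcongr)
    · exact (jetNorm_mul_le hw hX cH).trans (by gcongr)
  have b2 : jetNorm w N (fun t =>
      S s * (Y t - (H t - H s) * X t + X t * (H t - H s)) * P s) s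
      ≤ 1 / g * (y + g / 8 * x + x * (g / 8)) := by
    refine (jetNorm_mul_const_le hw (P s) c3).trans ?_
    have h1 := (jetNorm_const_mul_le (N := N) (s := s) hw (S s) c2).trans
      (mul_le_mul hs.norm_resolvent_le b1 (jetNorm_nonneg hw _ _ _) (by positivity))
    calc _ ≤ (1 / g * (y + g / 8 * x + x * (g / 8))) * 1 := by
          gcongr
          exact hs.norm_le
      _ = _ := mul_one _
  have b3 : jetNorm w N (fun t => (P t - P s) * X t) s ≤ 1 / 8 * x :=
    (jetNorm_mul_le hw cP hX).trans (by gcongr)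
  have b4 : jetNorm w N (fun t => (1 - P s) * (X t * (P t - P s))) s ≤ 1 * (x * (1 / 8)) := by
    refine (jetNorm_const_mul_le hw (1 - P s) c6).trans ?_
    refine mul_le_mul hs.norm_one_sub_le ?_ (jetNorm_nonneg hw _ _ _) zero_le_one
    exact (jetNorm_mul_le hw hX cP).trans (by gcongr)
  have b5 : x ≤ 1 / g * (y + g / 8 * x + x * (g / 8)) + 1 / 8 * x + 1 * (x * (1 / 8)) := by
    have h1 := (jetNorm_add_le (N := N) (s := s) hw (c4.sub c5) c7).trans
      (add_le_add ((jetNorm_sub_le hw c4 c5).trans (add_le_add b2 b3)) b4)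
    rwa [← hid] at h1
  have b6 : 1 / g * (y + g / 8 * x + x * (g / 8)) = y / g + x / 4 := by
    field_simp
    ring
  rw [b6] at b5
  calc x ≤ 2 * (y / g) := by linarith
    _ = _ := by ring

theorem star_deriv_proj (h : IsGappedFamily H P S E g) (t : ℝ) : star (deriv P t) = deriv P t := by
  have h1 := (h.hasDerivAt_proj t).star
  have h2 : (fun u => star (P u)) = P := funext fun u => (h.isolated u).selfAdjoint
  rw [h2] at h1
  rw [(h.hasDerivAt_proj t).deriv]
  exact h1.unique (h.hasDerivAt_proj t)

theorem compl_mul_deriv_mul_proj (h : IsGappedFamily H P S E g) (t : ℝ) :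
    (1 - P t) * deriv P t * P t = -(S t * deriv H t * P t) := by
  have ht := h.isolated t
  rw [h.deriv_proj]
  have e1 : (1 - P t) * P t = 0 := by rw [sub_mul, one_mul, ht.mul_self, sub_self]
  have e2 : (1 - P t) * S t = S t := by
    rw [sub_mul, one_mul, ht.proj_mul_resolvent, sub_zero]
  calc _ = -((1 - P t) * P t * deriv H t * S t * P t
        + (1 - P t) * S t * deriv H t * (P t * P t)) := by noncomm_ring
    _ = _ := by rw [e1, e2, ht.mul_self]; noncomm_ring

theorem deriv_proj_eq_add_star (h : IsGappedFamily H P S E g) (t : ℝ) :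
    deriv P t = (1 - P t) * deriv P t * P t + star ((1 - P t) * deriv P t * P t) := by
  have ht := h.isolated t
  rw [star_mul, star_mul, h.star_deriv_proj, star_sub, star_one, ht.selfAdjoint]
  have e1 : P t * deriv P t * P t = 0 := by
    rw [h.deriv_proj]
    calc _ = -(P t * P t * deriv H t * (S t * P t)
          + P t * S t * deriv H t * P t * P t) := by noncomm_ring
      _ = _ := by rw [ht.resolvent_mul_proj, ht.proj_mul_resolvent]; simp
  have e2 : (1 - P t) * deriv P t * (1 - P t) = 0 := by
    have f1 : (1 - P t) * P t = 0 := by rw [sub_mul, one_mul, ht.mul_self, sub_self]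
    have f2 : P t * (1 - P t) = 0 := by rw [mul_sub, mul_one, ht.mul_self, sub_self]
    rw [h.deriv_proj]
    calc _ = -((1 - P t) * P t * deriv H t * S t * (1 - P t)
          + (1 - P t) * S t * deriv H t * (P t * (1 - P t))) := by noncomm_ring
      _ = _ := by rw [f1, f2]; simp
  calc deriv P t = (1 - P t) * deriv P t * P t + P t * (deriv P t * (1 - P t))
        + P t * deriv P t * P t + (1 - P t) * deriv P t * (1 - P t) := by noncomm_ring
    _ = _ := by rw [e1, e2, add_zero, add_zero]

theorem isOffDiagonal_of_resolvent (h : IsGappedFamily H P S E g) (Z : ℝ → A) :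
    IsOffDiagonal P fun t => S t * Z t * P t where
  proj_mul t := by
    rw [← mul_assoc, ← mul_assoc, (h.isolated t).proj_mul_resolvent, zero_mul, zero_mul]
  mul_proj t := by rw [mul_assoc, (h.isolated t).mul_self]

theorem commutator_resolvent (h : IsGappedFamily H P S E g) (Z : ℝ → A) (t : ℝ) :
    H t * (S t * Z t * P t) - S t * Z t * P t * H t = (1 - P t) * Z t * P t := by
  have ht := h.isolated t
  rw [← ht.mul_resolvent, mul_assoc _ (P t), ht.mul_op]
  simp only [sub_mul, mul_smul_comm, smul_mul_assoc, one_mul, mul_assoc]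

/-- Jet bounds on a gapped family: the weights `w` are adapted to the derivative of `H` and to
the gap through `64 η ρ ≤ g`. -/
structure HasJetBound (H : ℝ → A) (g : ℝ) (w : ℕ → ℝ) (ρ η : ℝ) : Prop where
  weight : IsJetWeight w
  weight_succ_le : ∀ k, w (k + 1) ≤ ρ * w k
  rho_nonneg : 0 ≤ ρ
  eta_pos : 0 < η
  jetNorm_deriv_le : ∀ N s, jetNorm w N (deriv H) s ≤ η
  mul_le : 64 * η * ρ ≤ g

variable {ρ η : ℝ}

theorem jetNorm_op_sub_le (h : IsGappedFamily H P S E g) (hb : HasJetBound H g w ρ η) (N : ℕ)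
    (s : ℝ) : jetNorm w N (fun t => H t - H s) s ≤ g / 8 := by
  have hg := h.pos
  cases N with
  | zero =>
    rw [jetNorm_order_zero hb.weight, sub_self, norm_zero]
    positivity
  | succ N =>
    refine (jetNorm_sub_const_le hb.weight_succ_le H s N).trans ?_
    have h1 := mul_le_mul_of_nonneg_left (hb.jetNorm_deriv_le N s) hb.rho_nonneg
    linarith [hb.mul_le]

theorem jetNorm_proj_le_of (h : IsGappedFamily H P S E g)
    (hP : jetNorm w N (fun t => P t - P s) s ≤ 1 / 8) (hw : IsJetWeight w) :
    jetNorm w N P s ≤ 9 / 8 := by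
  have h1 := jetNorm_add_le (N := N) (s := s) (f := fun t => P t - P s) (g := fun _ => P s) hw
    (h.contDiff_proj.sub contDiff_const) contDiff_const
  simp only [sub_add_cancel, jetNorm_const hw] at h1
  have := (h.isolated s).norm_le
  linarith

theorem jetNorm_compl_le_of (h : IsGappedFamily H P S E g)
    (hP : jetNorm w N (fun t => P t - P s) s ≤ 1 / 8) (hw : IsJetWeight w) :
    jetNorm w N (fun t => 1 - P t) s ≤ 9 / 8 := by
  have h1 := jetNorm_sub_le (N := N) (s := s) (f := fun _ => 1 - P s) (g := fun t => P t - P s) hw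
    contDiff_const (h.contDiff_proj.sub contDiff_const)
  simp only [jetNorm_const hw, sub_sub, add_sub_cancel] at h1
  have := (h.isolated s).norm_one_sub_le
  linarith

theorem jetNorm_compl_mul_mul_proj_le_of (h : IsGappedFamily H P S E g)
    (hP : jetNorm w N (fun t => P t - P s) s ≤ 1 / 8) (hw : IsJetWeight w)
    {Z : ℝ → A} (hZ : ContDiff ℝ ∞ Z) :
    jetNorm w N (fun t => (1 - P t) * Z t * P t) s ≤ 2 * jetNorm w N Z s := by
  have cQ : ContDiff ℝ ∞ fun t => 1 - P t := contDiff_const.sub h.contDiff_proj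
  have h0 := jetNorm_nonneg hw N Z s
  calc _ ≤ jetNorm w N (fun t => (1 - P t) * Z t) s * jetNorm w N P s :=
        jetNorm_mul_le hw (cQ.mul hZ) h.contDiff_proj
    _ ≤ (9 / 8 * jetNorm w N Z s) * (9 / 8) := by
        refine mul_le_mul ((jetNorm_mul_le hw cQ hZ).trans ?_) (h.jetNorm_proj_le_of hP hw)
          (jetNorm_nonneg hw _ _ _) (by positivity)
        gcongr
        exact h.jetNorm_compl_le_of hP hw
    _ ≤ _ := by linarith

theorem jetNorm_offDiagonal_deriv_proj_le_of (h : IsGappedFamily H P S E g)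
    (hP : jetNorm w N (fun t => P t - P s) s ≤ 1 / 8)
    (hb : HasJetBound H g w ρ η) :
    jetNorm w N (fun t => (1 - P t) * deriv P t * P t) s ≤ 4 * η / g := by
  have hg := h.pos
  have cH' := h.contDiff.deriv_infty
  have hw := hb.weight
  simp only [h.compl_mul_deriv_mul_proj]
  rw [jetNorm_neg]
  have h1 := h.jetNorm_le_of_commutator_eq (N := N) (s := s) hw
    ((h.contDiff_resolvent.mul cH').mul h.contDiff_proj)
    (((contDiff_const.sub h.contDiff_proj).mul cH').mul h.contDiff_proj)
    (h.isOffDiagonal_of_resolvent (deriv H)) (h.commutator_resolvent (deriv H))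
    (h.jetNorm_op_sub_le hb N s) hP
  refine h1.trans ?_
  have h2 := h.jetNorm_compl_mul_mul_proj_le_of hP hw cH'
  have h3 := hb.jetNorm_deriv_le N s
  calc _ ≤ 2 / g * (2 * η) := by
        gcongr
        linarith
    _ = _ := by ring

theorem jetNorm_deriv_proj_le_of (h : IsGappedFamily H P S E g)
    (hP : jetNorm w N (fun t => P t - P s) s ≤ 1 / 8) (hb : HasJetBound H g w ρ η) :
    jetNorm w N (deriv P) s ≤ 8 * η / g := by
  have c : ContDiff ℝ ∞ fun t => (1 - P t) * deriv P t * P t :=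
    ((contDiff_const.sub h.contDiff_proj).mul h.contDiff_proj.deriv_infty).mul h.contDiff_proj
  have e : deriv P = fun t => (1 - P t) * deriv P t * P t
      + star ((1 - P t) * deriv P t * P t) := funext h.deriv_proj_eq_add_star
  rw [e]
  have cs : ContDiff ℝ ∞ fun t => star ((1 - P t) * deriv P t * P t) :=
    (starL' ℝ : A ≃L[ℝ] A).contDiff.comp c
  refine (jetNorm_add_le hb.weight c cs).trans ?_
  rw [jetNorm_star c]
  have := h.jetNorm_offDiagonal_deriv_proj_le_of hP hb
  calc _ ≤ 4 * η / g + 4 * η / g := add_le_add this this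
    _ = _ := by ring

/-- Induction on the order: a jet bound on `P` of order `N` bounds `P'` to the order `N`, hence
`P` to the order `N + 1`. -/
theorem jetNorm_proj_sub_le (h : IsGappedFamily H P S E g) (hb : HasJetBound H g w ρ η) (N : ℕ)
    (s : ℝ) : jetNorm w N (fun t => P t - P s) s ≤ 1 / 8 := by
  have hg := h.pos
  induction N with
  | zero =>
    rw [jetNorm_order_zero hb.weight, sub_self, norm_zero]
    positivity
  | succ N ih =>
    refine (jetNorm_sub_const_le hb.weight_succ_le P s N).trans ?_
    have h1 := h.jetNorm_deriv_proj_le_of ih hb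
    calc _ ≤ ρ * (8 * η / g) := mul_le_mul_of_nonneg_left h1 hb.rho_nonneg
      _ = 64 * η * ρ / g / 8 := by ring
      _ ≤ 1 / 8 := by
        have : 64 * η * ρ / g ≤ 1 := (div_le_one hg).2 hb.mul_le
        linarith

theorem jetNorm_compl_mul_mul_proj_le (h : IsGappedFamily H P S E g) (hb : HasJetBound H g w ρ η)
    {Z : ℝ → A} (hZ : ContDiff ℝ ∞ Z) (N : ℕ) (s : ℝ) :
    jetNorm w N (fun t => (1 - P t) * Z t * P t) s ≤ 2 * jetNorm w N Z s :=
  h.jetNorm_compl_mul_mul_proj_le_of (h.jetNorm_proj_sub_le hb N s) hb.weight hZ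

theorem jetNorm_resolvent_mul_le (h : IsGappedFamily H P S E g) (hb : HasJetBound H g w ρ η)
    {Z : ℝ → A} (hZ : ContDiff ℝ ∞ Z) (N : ℕ) (s : ℝ) :
    jetNorm w N (fun t => S t * Z t * P t) s
      ≤ 2 / g * jetNorm w N (fun t => (1 - P t) * Z t * P t) s :=
  h.jetNorm_le_of_commutator_eq hb.weight
    ((h.contDiff_resolvent.mul hZ).mul h.contDiff_proj)
    (((contDiff_const.sub h.contDiff_proj).mul hZ).mul h.contDiff_proj)
    (h.isOffDiagonal_of_resolvent Z) (h.commutator_resolvent Z)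
    (h.jetNorm_op_sub_le hb N s) (h.jetNorm_proj_sub_le hb N s)

theorem jetNorm_deriv_proj_le (h : IsGappedFamily H P S E g) (hb : HasJetBound H g w ρ η)
    (N : ℕ) (s : ℝ) : jetNorm w N (deriv P) s ≤ 8 * η / g :=
  h.jetNorm_deriv_proj_le_of (h.jetNorm_proj_sub_le hb N s) hb

end IsGappedFamily

end SpectralJets

/-! ### Nearly invariant graphs over the spectral subspace -/

section Graph

variable {A : Type*} [CStarAlgebra A] {w : ℕ → ℝ} {H P S : ℝ → A} {E : ℝ → ℝ}
  {g ρ η d : ℝ} {κ : ℂ} {N M n : ℕ} {s : ℝ}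

/-- The inhomogeneous term `P' + K' + K P' K` of the Riccati equation which expresses that the
graph of `K` over the range of `P` is invariant under the evolution; only its block from the
range of `P` to that of `1 - P` matters. -/
noncomputable def graphTerm (P K : ℝ → A) (t : ℝ) : A :=
  deriv P t + deriv K t + K t * deriv P t * K t

/-- Picard iterates for the Riccati equation `[H, K] = κ (1 - P) (P' + K' + K P' K) P`, where
`κ = i / τ`. Each iteration costs one derivative. -/
noncomputable def adiabaticGraph (P S : ℝ → A) (κ : ℂ) : ℕ → ℝ → A
  | 0 => fun _ => 0
  | n + 1 => fun t => κ • (S t * graphTerm P (adiabaticGraph P S κ n) t * P t)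

theorem ContDiff.graphTerm {K : ℝ → A} (hP : ContDiff ℝ ∞ P) (hK : ContDiff ℝ ∞ K) :
    ContDiff ℝ ∞ (graphTerm P K) :=
  (hP.deriv_infty.add hK.deriv_infty).add ((hK.mul hP.deriv_infty).mul hK)

theorem two_mul_mul_one_sub_half_pow_le_one {θ : ℝ} (h0 : 0 ≤ θ) (h2 : θ ≤ 1 / 2) (m : ℕ) :
    2 * θ * (1 - (1 / 2) ^ m) ≤ 1 := by
  have h1 : (1 : ℝ) - (1 / 2) ^ m ≤ 1 := sub_le_self _ (by positivity)
  have h3 : (0 : ℝ) ≤ 1 - (1 / 2) ^ m :=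
    sub_nonneg.2 (pow_le_one₀ (by norm_num) (by norm_num))
  nlinarith

namespace IsGappedFamily

theorem contDiff_adiabaticGraph (h : IsGappedFamily H P S E g) (κ : ℂ) (n : ℕ) :
    ContDiff ℝ ∞ (adiabaticGraph P S κ n) := by
  induction n with
  | zero => exact contDiff_const
  | succ n ih =>
    exact ((h.contDiff_resolvent.mul (h.contDiff_proj.graphTerm ih)).mul
      h.contDiff_proj).const_smul κ

theorem isOffDiagonal_adiabaticGraph (h : IsGappedFamily H P S E g) (κ : ℂ) (n : ℕ) :
    IsOffDiagonal P (adiabaticGraph P S κ n) := by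
  cases n with
  | zero => exact ⟨fun t => mul_zero _, fun t => zero_mul _⟩
  | succ n =>
    have h1 := h.isOffDiagonal_of_resolvent (graphTerm P (adiabaticGraph P S κ n))
    refine ⟨fun t => ?_, fun t => ?_⟩
    · rw [adiabaticGraph, mul_smul_comm, h1.proj_mul, smul_zero]
    · rw [adiabaticGraph, smul_mul_assoc, h1.mul_proj]

theorem commutator_adiabaticGraph_succ (h : IsGappedFamily H P S E g) (κ : ℂ) (n : ℕ) (t : ℝ) :
    H t * adiabaticGraph P S κ (n + 1) t - adiabaticGraph P S κ (n + 1) t * H t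
      = κ • ((1 - P t) * graphTerm P (adiabaticGraph P S κ n) t * P t) := by
  rw [adiabaticGraph, mul_smul_comm, smul_mul_assoc, ← smul_sub, h.commutator_resolvent]

theorem adiabaticGraph_succ_sub (P S : ℝ → A) (κ : ℂ) (n : ℕ) (t : ℝ) :
    adiabaticGraph P S κ (n + 2) t - adiabaticGraph P S κ (n + 1) t
      = κ • (S t * (graphTerm P (adiabaticGraph P S κ (n + 1)) t
        - graphTerm P (adiabaticGraph P S κ n) t) * P t) := by
  rw [adiabaticGraph, adiabaticGraph, ← smul_sub, ← sub_mul, ← mul_sub]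

/-- The inhomogeneous term is Lipschitz in `K`, at the cost of one derivative. -/
theorem jetNorm_graphTerm_sub_le (h : IsGappedFamily H P S E g) (hb : HasJetBound H g w ρ η)
    (hd : ∀ k ≤ N, w k ≤ d * w (k + 1)) (hdη : 16 * η / g ≤ d) {K L : ℝ → A}
    (hK : ContDiff ℝ ∞ K) (hL : ContDiff ℝ ∞ L) (bK : jetNorm w N K s ≤ 1)
    (bL : jetNorm w N L s ≤ 1) :
    jetNorm w N (fun t => graphTerm P L t - graphTerm P K t) s
      ≤ 2 * d * jetNorm w (N + 1) (fun t => L t - K t) s := by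
  have hg := h.pos
  have hw := hb.weight
  have hη := hb.eta_pos
  have hd0 : 0 ≤ d := le_trans (by positivity) hdη
  have cP := h.contDiff_proj.deriv_infty
  have cD : ContDiff ℝ ∞ fun t => L t - K t := hL.sub hK
  have e : (fun t => graphTerm P L t - graphTerm P K t) = fun t =>
      deriv (fun u => L u - K u) t + (L t * deriv P t * (L t - K t)
        + (L t - K t) * deriv P t * K t) := by
    funext t
    have : deriv (fun u => L u - K u) t = deriv L t - deriv K t :=
      deriv_sub (hL.differentiable (by simp)).differentiableAt
        (hK.differentiable (by simp)).differentiableAt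
    rw [this, graphTerm, graphTerm]
    noncomm_ring
  set x := jetNorm w (N + 1) (fun t => L t - K t) s
  have hx0 : 0 ≤ x := jetNorm_nonneg hw _ _ _
  have hx : jetNorm w N (fun t => L t - K t) s ≤ x := jetNorm_mono hw (Nat.le_succ N) _ _
  have hP := h.jetNorm_deriv_proj_le hb N s
  have b1 : jetNorm w N (fun t => L t * deriv P t * (L t - K t)) s ≤ 1 * (8 * η / g) * x := by
    refine (jetNorm_mul_le hw (hL.mul cP) cD).trans ?_
    refine mul_le_mul ?_ hx (jetNorm_nonneg hw _ _ _) (by positivity)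
    exact (jetNorm_mul_le hw hL cP).trans
      (mul_le_mul bL hP (jetNorm_nonneg hw _ _ _) zero_le_one)
  have b2 : jetNorm w N (fun t => (L t - K t) * deriv P t * K t) s ≤ x * (8 * η / g) * 1 := by
    refine (jetNorm_mul_le hw (cD.mul cP) hK).trans ?_
    refine mul_le_mul ?_ bK (jetNorm_nonneg hw _ _ _) (by positivity)
    exact (jetNorm_mul_le hw cD cP).trans (mul_le_mul hx hP (jetNorm_nonneg hw _ _ _) hx0)
  rw [e]
  have b3 := (jetNorm_add_le (N := N) (s := s) hw cD.deriv_infty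
    (((hL.mul cP).mul cD).add ((cD.mul cP).mul hK))).trans
    (add_le_add (jetNorm_deriv_le hw hd hd0 _ s)
      ((jetNorm_add_le hw ((hL.mul cP).mul cD) ((cD.mul cP).mul hK)).trans (add_le_add b1 b2)))
  refine b3.trans ?_
  have : 16 * η / g * x ≤ d * x := mul_le_mul_of_nonneg_right hdη hx0
  calc _ = d * x + 16 * η / g * x := by ring
    _ ≤ _ := by linarith

/-- The iterates form a contracting sequence as long as derivatives are available; the ratio is
`8 d ‖κ‖ / g`, with `d` the cost of a derivative. -/
theorem jetNorm_adiabaticGraph_le (h : IsGappedFamily H P S E g) (hb : HasJetBound H g w ρ η)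
    (hd : ∀ k < M, w k ≤ d * w (k + 1)) (hdη : 16 * η / g ≤ d) {θ : ℝ}
    (hθ : 8 * d * ‖κ‖ / g ≤ θ) (hθ2 : θ ≤ 1 / 2) (n : ℕ) :
    ∀ N, N + n ≤ M → ∀ s,
      jetNorm w N (adiabaticGraph P S κ n) s ≤ 2 * θ * (1 - (1 / 2) ^ n) ∧
      jetNorm w N (fun t => adiabaticGraph P S κ (n + 1) t - adiabaticGraph P S κ n t) s
        ≤ θ ^ (n + 1) := by
  have hg := h.pos
  have hw := hb.weight
  have hη := hb.eta_pos
  have hd0 : 0 ≤ d := le_trans (by positivity) hdη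
  have hθ0 : 0 ≤ θ := le_trans (by positivity) hθ
  induction n with
  | zero =>
    intro N _ s
    constructor
    · simp only [adiabaticGraph, jetNorm_const hw]
      simp
    · have e : (fun t => adiabaticGraph P S κ (0 + 1) t - adiabaticGraph P S κ 0 t)
          = fun t => κ • (S t * deriv P t * P t) := by
        funext t
        simp [adiabaticGraph, graphTerm]
      have cP := h.contDiff_proj.deriv_infty
      rw [e, jetNorm_const_smul κ ((h.contDiff_resolvent.mul cP).mul h.contDiff_proj),
        zero_add, pow_one]
      refine le_trans ?_ hθ
      have h1 := h.jetNorm_resolvent_mul_le hb cP N s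
      have h2 := h.jetNorm_offDiagonal_deriv_proj_le_of (h.jetNorm_proj_sub_le hb N s) hb
      calc _ ≤ ‖κ‖ * (2 / g * (4 * η / g)) := by
            gcongr
            exact h1.trans (by gcongr)
        _ = (16 * η / g) * (‖κ‖ / g) / 2 := by ring
        _ ≤ d * (‖κ‖ / g) / 2 := by gcongr
        _ ≤ d * (‖κ‖ / g) * 8 := by
            have : 0 ≤ d * (‖κ‖ / g) := by positivity
            linarith
        _ = _ := by ring
  | succ n ih =>
    have hstep : ∀ N, N + n ≤ M → ∀ s,
        jetNorm w N (adiabaticGraph P S κ (n + 1)) s ≤ 2 * θ * (1 - (1 / 2) ^ (n + 1)) := by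
      intro N hN s
      obtain ⟨i1, i2⟩ := ih N hN s
      have cK := h.contDiff_adiabaticGraph κ n
      have e : adiabaticGraph P S κ (n + 1) = fun t => adiabaticGraph P S κ n t
          + (adiabaticGraph P S κ (n + 1) t - adiabaticGraph P S κ n t) := by
        funext t; abel
      rw [e]
      refine (jetNorm_add_le hw cK ((h.contDiff_adiabaticGraph κ (n + 1)).sub cK)).trans ?_
      have h1 : θ ^ (n + 1) ≤ θ * (1 / 2) ^ n := by
        rw [pow_succ']
        gcongr
      refine (add_le_add i1 (i2.trans h1)).trans_eq ?_
      rw [pow_succ]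
      ring
    have hone := two_mul_mul_one_sub_half_pow_le_one hθ0 hθ2
    intro N hN s
    refine ⟨hstep N (by omega) s, ?_⟩
    have cK := h.contDiff_adiabaticGraph κ n
    have cL := h.contDiff_adiabaticGraph κ (n + 1)
    have cD := (h.contDiff_proj.graphTerm cL).sub (h.contDiff_proj.graphTerm cK)
    simp only [adiabaticGraph_succ_sub]
    rw [jetNorm_const_smul κ ((h.contDiff_resolvent.mul cD).mul h.contDiff_proj)]
    have h1 := h.jetNorm_resolvent_mul_le hb cD N s
    have h2 := h.jetNorm_compl_mul_mul_proj_le hb cD N s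
    have h3 := h.jetNorm_graphTerm_sub_le hb (fun k hk => hd k (by omega)) hdη cK cL
      ((ih N (by omega) s).1.trans (hone n)) ((hstep N (by omega) s).trans (hone (n + 1)))
      (N := N) (s := s)
    have h4 := (ih (N + 1) (by omega) s).2
    calc _ ≤ ‖κ‖ * (2 / g * (2 * (2 * d * θ ^ (n + 1)))) := by
          gcongr
          refine h1.trans ?_
          gcongr
          refine h2.trans ?_
          gcongr
          exact h3.trans (by gcongr)
      _ = 8 * d * ‖κ‖ / g * θ ^ (n + 1) := by ring
      _ ≤ θ * θ ^ (n + 1) := by gcongr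
      _ = _ := by rw [← pow_succ']

/-- The defect of the Riccati equation for the iterate `n + 1` is exponentially small in `n`. -/
theorem norm_graphDefect_le (h : IsGappedFamily H P S E g) (hb : HasJetBound H g w ρ η)
    (hd : ∀ k < n + 1, w k ≤ d * w (k + 1)) (hdη : 16 * η / g ≤ d) {θ : ℝ}
    (hθ : 8 * d * ‖κ‖ / g ≤ θ) (hθ2 : θ ≤ 1 / 2) (s : ℝ) :
    ‖(1 - P s) * (graphTerm P (adiabaticGraph P S κ (n + 1)) s
      - graphTerm P (adiabaticGraph P S κ n) s) * P s‖ ≤ 4 * d * θ ^ (n + 1) := by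
  have hg := h.pos
  have hη := hb.eta_pos
  have hd0 : 0 ≤ d := le_trans (by positivity) hdη
  have hθ0 : 0 ≤ θ := le_trans (by positivity) hθ
  have hK := h.jetNorm_adiabaticGraph_le hb hd hdη hθ hθ2
  have hone := two_mul_mul_one_sub_half_pow_le_one hθ0 hθ2
  have cK := h.contDiff_adiabaticGraph κ n
  have cL := h.contDiff_adiabaticGraph κ (n + 1)
  have cD := (h.contDiff_proj.graphTerm cL).sub (h.contDiff_proj.graphTerm cK)
  have h2 := h.jetNorm_compl_mul_mul_proj_le hb cD 0 s
  rw [jetNorm_order_zero hb.weight] at h2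
  have h3 := h.jetNorm_graphTerm_sub_le hb (N := 0) (s := s) (fun k hk => hd k (by omega)) hdη
    cK cL (((hK n 0 (by omega) s).1).trans (hone n))
    (((hK (n + 1) 0 (by omega) s).1).trans (hone (n + 1)))
  have h4 := (hK n (0 + 1) (by omega) s).2
  calc _ ≤ 2 * (2 * d * θ ^ (n + 1)) := by
        refine h2.trans ?_
        gcongr
        exact h3.trans (by gcongr)
    _ = _ := by ring

theorem norm_adiabaticGraph_le (h : IsGappedFamily H P S E g) (hb : HasJetBound H g w ρ η)
    (hd : ∀ k < n, w k ≤ d * w (k + 1)) (hdη : 16 * η / g ≤ d) {θ : ℝ}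
    (hθ : 8 * d * ‖κ‖ / g ≤ θ) (hθ2 : θ ≤ 1 / 2) (s : ℝ) :
    ‖adiabaticGraph P S κ n s‖ ≤ 2 * θ := by
  have hg := h.pos
  have hη := hb.eta_pos
  have hd0 : 0 ≤ d := le_trans (by positivity) hdη
  have hθ0 : 0 ≤ θ := le_trans (by positivity) hθ
  have h1 := (h.jetNorm_adiabaticGraph_le hb hd hdη hθ hθ2 n 0 (by omega) s).1
  rw [jetNorm_order_zero hb.weight] at h1
  refine h1.trans (mul_le_of_le_one_right (by positivity) ?_)
  exact sub_le_self _ (by positivity)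

/-- Before the switching starts, the graph is the spectral subspace itself. -/
theorem adiabaticGraph_eq_zero (h : IsGappedFamily H P S E g) (hH : ∀ t < 0, deriv H t = 0)
    (κ : ℂ) (n : ℕ) : adiabaticGraph P S κ n 0 = 0 := by
  have hneg : ∀ m, ∀ t < 0, adiabaticGraph P S κ m t = 0 := by
    intro m
    induction m with
    | zero => exact fun t _ => rfl
    | succ m ih =>
      intro t ht
      have h1 : deriv P t = 0 := by rw [h.deriv_proj]; simp [hH t ht]
      have h2 : deriv (adiabaticGraph P S κ m) t = 0 := by
        have : adiabaticGraph P S κ m =ᶠ[nhds t] fun _ => 0 := by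
          filter_upwards [Iio_mem_nhds ht] with u hu using ih u hu
        rw [this.deriv_eq, deriv_const]
      simp [adiabaticGraph, graphTerm, h1, h2]
  have hc := (h.contDiff_adiabaticGraph κ n).continuous
  have hcl : IsClosed {t | adiabaticGraph P S κ n t = 0} := isClosed_eq hc continuous_const
  have : closure (Iio (0 : ℝ)) ⊆ {t | adiabaticGraph P S κ n t = 0} :=
    hcl.closure_subset_iff.2 fun t ht => hneg n t ht
  rw [closure_Iio] at this
  exact this (mem_Iic.2 le_rfl)

/-- Up to the defect of the Riccati equation, `P + K` intertwines the evolution generated by `-z H`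
with some evolution in the range of `P`, for every `K` of the right shape. -/
theorem hasDerivAt_proj_add (h : IsGappedFamily H P S E g) {K : ℝ → A} (hK : ContDiff ℝ ∞ K)
    (hPK : IsOffDiagonal P K) (z : ℂ) (t : ℝ) :
    HasDerivAt (fun u => P u + K u)
      (-(z • (H t * (P t + K t)))
        + (P t + K t) * (z • E t • (1 : A) + deriv P t * (1 - P t - K t))
        + ((1 - P t) * graphTerm P K t * P t + z • (H t * K t - K t * H t))) t := by
  have ht := h.isolated t
  have dP : HasDerivAt P (deriv P t) t :=
    (h.contDiff_proj.differentiable (by simp)).differentiableAt.hasDerivAt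
  have dK : HasDerivAt K (deriv K t) t :=
    (hK.differentiable (by simp)).differentiableAt.hasDerivAt
  -- derivatives of `P K = 0`, `K P = K` and `P P = P`
  have e1 : deriv P t * K t + P t * deriv K t = 0 := by
    have h1 := dP.mul dK
    have h2 : P * K = fun _ => 0 := funext hPK.proj_mul
    rw [h2] at h1
    exact h1.unique (hasDerivAt_const t (0 : A))
  have e2 : deriv K t * P t + K t * deriv P t = deriv K t := by
    have h1 := dK.mul dP
    have h2 : K * P = K := funext hPK.mul_proj
    rw [h2] at h1
    exact h1.unique dK
  have e3 : deriv P t * P t + P t * deriv P t = deriv P t := by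
    have h1 := dP.mul dP
    have h2 : P * P = P := funext fun u => (h.isolated u).mul_self
    rw [h2] at h1
    exact h1.unique dP
  have e4 : K t * H t = E t • K t := by
    rw [← hPK.mul_proj t, mul_assoc, ht.mul_op, mul_smul_comm]
  have e5 := hPK.proj_mul t
  have e6 := hPK.mul_proj t
  have e7 := ht.mul_self
  refine (dP.add dK).congr_deriv ?_
  have f1 : P t * deriv P t * P t = 0 := by
    have h1 : P t * (deriv P t * P t + P t * deriv P t) * P t = P t * deriv P t * P t := by
      rw [e3]
    have h2 : P t * (deriv P t * P t + P t * deriv P t) * P t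
        = P t * deriv P t * (P t * P t) + P t * P t * deriv P t * P t := by noncomm_ring
    rw [h2, e7] at h1
    exact left_eq_add.1 h1.symm
  have f2 : K t * deriv P t * P t = 0 := by
    have h1 : K t * deriv P t * P t = K t * (P t * deriv P t * P t) := by
      rw [← mul_assoc, ← mul_assoc, e6]
    rw [h1, f1, mul_zero]
  have f3 : P t * deriv P t * K t + P t * deriv K t * P t = 0 := by
    have h1 : P t * (deriv P t * K t + P t * deriv K t) * P t
        = P t * deriv P t * (K t * P t) + P t * P t * deriv K t * P t := by noncomm_ring
    rw [e1, e6, e7] at h1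
    rw [← h1]
    simp
  have key : (P t + K t) * (deriv P t * (1 - P t - K t)) + (1 - P t) * graphTerm P K t * P t
      = deriv P t + deriv K t := by
    calc _ = (deriv P t * P t + P t * deriv P t) + (deriv K t * P t + K t * deriv P t)
          - (P t * deriv P t * P t + P t * deriv P t * P t)
          - (P t * deriv P t * K t + P t * deriv K t * P t) - K t * deriv P t * P t
          + K t * deriv P t * (K t * P t) - K t * deriv P t * K t
          - P t * K t * deriv P t * K t * P t := by
            unfold graphTerm
            noncomm_ring
      _ = _ := by
            rw [e2, e3, e5, e6, f1, f2, f3]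
            noncomm_ring
  rw [← key, mul_add (H t), ht.op_mul, e4, mul_add (P t + K t)]
  simp only [add_mul, mul_smul_comm, mul_one, smul_add, smul_sub]
  abel

end IsGappedFamily

end Graph

/-! ### The distance of a solution to a nearly invariant graph -/

section Energy

open SwitchingAdiabatic

variable {𝓗 : Type*} [NormedAddCommGroup 𝓗] [InnerProductSpace ℂ 𝓗]

theorem hasDerivWithinAt_operator_apply {T : ℝ → 𝓗 →L[ℂ] 𝓗} {T' : 𝓗 →L[ℂ] 𝓗} {v : ℝ → 𝓗} {v' : 𝓗}
    {D : Set ℝ} {s : ℝ} (hT : HasDerivAt T T' s) (hv : HasDerivWithinAt v v' D s) :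
    HasDerivWithinAt (fun t => T t (v t)) (T' (v s) + T s v') D s := by
  have h1 : HasDerivAt (fun t => (T t).restrictScalars ℝ) (T'.restrictScalars ℝ) s :=
    ((ContinuousLinearMap.restrictScalarsL ℂ 𝓗 𝓗 ℝ ℝ).hasFDerivAt.comp_hasDerivAt s hT)
  exact h1.hasDerivWithinAt.clm_apply hv

variable [CompleteSpace 𝓗]

theorem re_inner_smul_selfAdjoint {a : 𝓗 →L[ℂ] 𝓗} (ha : IsSelfAdjoint a) (τ : ℝ) (v : 𝓗) :
    RCLike.re (inner ℂ v ((Complex.I * (τ : ℂ)) • a v)) = 0 := by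
  have h1 : (starRingEnd ℂ) (inner ℂ v (a v)) = inner ℂ v (a v) := by
    rw [inner_conj_symm]
    exact (ContinuousLinearMap.isSelfAdjoint_iff_isSymmetric.1 ha) v v
  have h2 : (inner ℂ v (a v)).im = 0 := Complex.conj_eq_iff_im.1 h1
  rw [inner_smul_right]
  simp [h2]

/-- Energy estimate: if `φ' = -i τ H φ + F` on `[0, 1]`, then `‖φ‖²` varies at most by a bound on
`2 |⟨φ, F⟩|`. -/
theorem norm_sq_le_of_energy {H : ℝ → 𝓗 →L[ℂ] 𝓗} (hH : ∀ s, IsSelfAdjoint (H s)) {τ b : ℝ}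
    {φ F : ℝ → 𝓗}
    (hφ : ∀ s ∈ Icc (0 : ℝ) 1,
      HasDerivWithinAt φ (-((Complex.I * (τ : ℂ)) • H s (φ s)) + F s) (Icc 0 1) s)
    (hF : ∀ s ∈ Icc (0 : ℝ) 1, 2 * |RCLike.re (inner ℂ (φ s) (F s))| ≤ b) {s : ℝ}
    (hs : s ∈ Icc (0 : ℝ) 1) : |‖φ s‖ ^ 2 - ‖φ 0‖ ^ 2| ≤ b := by
  have h0 : (0 : ℝ) ∈ Icc (0 : ℝ) 1 := ⟨le_rfl, zero_le_one⟩
  have hb : 0 ≤ b := le_trans (by positivity) (hF 0 h0)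
  let _ : InnerProductSpace ℝ 𝓗 := InnerProductSpace.rclikeToReal ℂ 𝓗
  have key := (convex_Icc (0 : ℝ) 1).norm_image_sub_le_of_norm_hasDerivWithin_le
    (f := fun t => ‖φ t‖ ^ 2) (C := b)
    (fun t ht => (hφ t ht).norm_sq) (fun t ht => ?_) h0 hs
  · rw [Real.norm_eq_abs, Real.norm_eq_abs] at key
    refine key.trans (mul_le_of_le_one_right hb ?_)
    rw [sub_zero, abs_of_nonneg hs.1]
    exact hs.2
  · rw [real_inner_eq_re_inner ℂ, inner_add_right, inner_neg_right, map_add, map_neg,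
      re_inner_smul_selfAdjoint (hH t), neg_zero, zero_add, Real.norm_eq_abs, abs_mul]
    simpa using hF t ht

theorem norm_eq_of_isSchrodingerSolution {H : ℝ → 𝓗 →L[ℂ] 𝓗} (hH : ∀ s, IsSelfAdjoint (H s))
    {τ : ℝ} {ψ : ℝ → 𝓗} (hψ : IsSchrodingerSolution H τ ψ) {s : ℝ} (hs : s ∈ Icc (0 : ℝ) 1) :
    ‖ψ s‖ = ‖ψ 0‖ := by
  have h := norm_sq_le_of_energy (φ := ψ) (F := fun _ => 0) (b := 0) (τ := τ) hH
    (fun t ht => by simpa [neg_smul] using hψ t ht) (fun t _ => by simp) hs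
  have h1 : ‖ψ s‖ ^ 2 = ‖ψ 0‖ ^ 2 := sub_eq_zero.1 (abs_nonpos_iff.1 h)
  exact (pow_left_inj₀ (norm_nonneg _) (norm_nonneg _) two_ne_zero).1 h1

section GraphProjection

variable {A : Type*} [CStarAlgebra A] {p k : A}

theorem isUnit_one_add_star_mul_self (hk : ‖k‖ ≤ 1 / 2) : IsUnit (1 + star k * k) := by
  have h1 : ‖-(star k * k)‖ < 1 := by
    rw [norm_neg, CStarRing.norm_star_mul_self]
    nlinarith [norm_nonneg k]
  have := isUnit_one_sub_of_norm_lt_one h1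
  rwa [sub_neg_eq_add] at this

theorem norm_inverse_one_add_star_mul_self_le [Nontrivial A] (hk : ‖k‖ ≤ 1 / 2) :
    ‖Ring.inverse (1 + star k * k)‖ ≤ 4 / 3 := by
  set G := Ring.inverse (1 + star k * k)
  have h1 : G = 1 - star k * k * G := by
    have := Ring.mul_inverse_cancel _ (isUnit_one_add_star_mul_self hk)
    rw [add_mul, one_mul] at this
    rw [← this]
    exact (add_sub_cancel_right _ _).symm
  have h2 : ‖star k * k * G‖ ≤ 1 / 4 * ‖G‖ := by
    refine (norm_mul_le _ _).trans (mul_le_mul_of_nonneg_right ?_ (norm_nonneg _))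
    rw [CStarRing.norm_star_mul_self]
    nlinarith [norm_nonneg k]
  have h3 : ‖G‖ ≤ 1 + 1 / 4 * ‖G‖ := by
    calc ‖G‖ = ‖1 - star k * k * G‖ := by rw [← h1]
      _ ≤ ‖(1 : A)‖ + ‖star k * k * G‖ := norm_sub_le _ _
      _ ≤ _ := by rw [CStarRing.norm_one]; gcongr
  linarith

/-- `v (1 + k⋆ k)⁻¹ v⋆`, with `v = p + k`, is the orthogonal projection onto the range of `v`: its
complement is orthogonal to that range. -/
theorem star_mul_graphProjection (hp : p * p = p) (hsp : star p = p) (hpk : p * k = 0)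
    (hkp : k * p = k) (hk : ‖k‖ ≤ 1 / 2) :
    star (p + k) * ((p + k) * (Ring.inverse (1 + star k * k) * star (p + k))) = star (p + k) := by
  set G := Ring.inverse (1 + star k * k)
  have hskp : star k * p = 0 := by rw [← hsp, ← star_mul, hpk, star_zero]
  have hpsk : p * star k = star k := by
    conv_lhs => rw [← hsp, ← star_mul, hkp]
  have hu := Ring.mul_inverse_cancel _ (isUnit_one_add_star_mul_self hk)
  have h1 : star (p + k) * (p + k) = (1 + star k * k) - (1 - p) := by
    rw [star_add, hsp, add_mul, mul_add, mul_add, hp, hpk, hskp]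
    abel
  have h2 : (1 - p) * G = 1 - p := by
    have : (1 - p) * (1 + star k * k) = 1 - p := by
      rw [mul_add, mul_one, ← mul_assoc, sub_mul, one_mul, hpsk, sub_self, zero_mul, add_zero]
    calc (1 - p) * G = (1 - p) * (1 + star k * k) * G := by rw [this]
      _ = _ := by rw [mul_assoc, hu, mul_one]
  have h3 : star (p + k) * (p + k) * G = p := by
    rw [h1, sub_mul, hu, h2]
    abel
  rw [← mul_assoc, ← mul_assoc, h3, star_add, hsp, mul_add, hp, hpsk]

end GraphProjection

/-- A solution that starts in a nearly invariant graph stays close to it, hence close to the range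
of `P`. The point `(P + K) c` of the graph next to `ψ` has coordinate `c = (1 + K⋆ K)⁻¹ (P + K)⋆ ψ`,
and the derivative of `‖ψ - (P + K) c‖²` only involves the defect `r`: neither `Λ`, which is of
size `τ`, nor the derivative of `c` contributes, since `ψ - (P + K) c` is orthogonal to the
graph. -/
theorem norm_sub_projection_le {H P K Λ r : ℝ → 𝓗 →L[ℂ] 𝓗} {ψ : ℝ → 𝓗} {τ δ κ : ℝ}
    (hH : ∀ s, IsSelfAdjoint (H s)) (hP : ContDiff ℝ ∞ P) (hK : ContDiff ℝ ∞ K)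
    (hPP : ∀ s, P s * P s = P s) (hPs : ∀ s, star (P s) = P s) (hP1 : ∀ s, ‖P s‖ ≤ 1)
    (hPK : IsOffDiagonal P K) (hκ : κ ≤ 1 / 2) (hK1 : ∀ s, ‖K s‖ ≤ κ)
    (hV : ∀ s, HasDerivAt (fun t => P t + K t)
      (-((Complex.I * (τ : ℂ)) • (H s * (P s + K s))) + (P s + K s) * Λ s + r s) s)
    (hr : ∀ s, ‖r s‖ ≤ δ) (hψ : IsSchrodingerSolution H τ ψ) (hψ0 : ‖ψ 0‖ = 1)
    (hPψ : P 0 (ψ 0) = ψ 0) (hK0 : K 0 = 0) {s : ℝ} (hs : s ∈ Icc (0 : ℝ) 1) :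
    ∃ c : 𝓗, ‖ψ s - P s c‖ ≤ Real.sqrt (16 * δ) + 2 * κ := by
  have hnt : Nontrivial 𝓗 := ⟨ψ 0, 0, by rw [← norm_ne_zero_iff, hψ0]; exact one_ne_zero⟩
  have hK2 : ∀ t, ‖K t‖ ≤ 1 / 2 := fun t => (hK1 t).trans hκ
  have hδ : 0 ≤ δ := (norm_nonneg _).trans (hr 0)
  set T : ℝ → 𝓗 →L[ℂ] 𝓗 := fun t => Ring.inverse (1 + star (K t) * K t) * star (P t + K t)
    with hT
  have hVn : ∀ t, ‖P t + K t‖ ≤ 3 / 2 := fun t =>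
    (norm_add_le _ _).trans (by linarith [hP1 t, hK2 t])
  have hTn : ∀ t, ‖T t‖ ≤ 2 := fun t => by
    refine (norm_mul_le _ _).trans ?_
    rw [norm_star]
    calc _ ≤ 4 / 3 * (3 / 2 : ℝ) := mul_le_mul (norm_inverse_one_add_star_mul_self_le (hK2 t))
          (hVn t) (norm_nonneg _) (by norm_num)
      _ = 2 := by norm_num
  have cstar : ∀ {f : ℝ → 𝓗 →L[ℂ] 𝓗}, ContDiff ℝ ∞ f → ContDiff ℝ ∞ fun t => star (f t) :=
    fun hf => (starL' ℝ : (𝓗 →L[ℂ] 𝓗) ≃L[ℝ] (𝓗 →L[ℂ] 𝓗)).contDiff.comp hf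
  have cT : ContDiff ℝ ∞ T := by
    refine ContDiff.mul ?_ (cstar (hP.add hK))
    rw [contDiff_iff_contDiffAt]
    intro t
    obtain ⟨u, hu⟩ := isUnit_one_add_star_mul_self (hK2 t)
    have hi : ContDiffAt ℝ ∞ Ring.inverse (1 + star (K t) * K t) := by
      rw [← hu]
      exact contDiffAt_ringInverse ℝ u
    have hc : ContDiff ℝ ∞ fun t => 1 + star (K t) * K t :=
      contDiff_const.add ((cstar hK).mul hK)
    exact ContDiffAt.comp t (f := fun t => 1 + star (K t) * K t) hi hc.contDiffAt
  have hψn : ∀ t ∈ Icc (0 : ℝ) 1, ‖ψ t‖ = 1 := fun t ht => by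
    rw [norm_eq_of_isSchrodingerSolution hH hψ ht, hψ0]
  set c : ℝ → 𝓗 := fun t => T t (ψ t) with hc
  have hcn : ∀ t ∈ Icc (0 : ℝ) 1, ‖c t‖ ≤ 2 := fun t ht => by
    refine ((T t).le_opNorm _).trans ?_
    rw [hψn t ht, mul_one]
    exact hTn t
  set φ : ℝ → 𝓗 := fun t => ψ t - (P t + K t) (c t) with hφ
  have horth : ∀ t v, inner ℂ (φ t) ((P t + K t) v) = 0 := by
    intro t v
    rw [← ContinuousLinearMap.adjoint_inner_left]
    have h1 := star_mul_graphProjection (hPP t) (hPs t) (hPK.proj_mul t) (hPK.mul_proj t) (hK2 t)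
    have h2 : (star (P t + K t)) (φ t) = 0 := by
      rw [hφ]
      dsimp only
      rw [map_sub, sub_eq_zero]
      exact (DFunLike.congr_fun h1 (ψ t)).symm
    rw [← ContinuousLinearMap.star_eq_adjoint, h2, inner_zero_left]
  -- the tangential part of the velocity of `(P + K) c` is orthogonal to `φ`
  have hder : ∀ t ∈ Icc (0 : ℝ) 1, ∃ v,
      HasDerivWithinAt φ (-((Complex.I * (τ : ℂ)) • H t (φ t)) +
        (-((P t + K t) v) - r t (c t))) (Icc 0 1) t := by
    intro t ht
    have dT : HasDerivAt T (deriv T t) t :=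
      (cT.differentiable (by simp)).differentiableAt.hasDerivAt
    have dc : HasDerivWithinAt c _ (Icc 0 1) t := hasDerivWithinAt_operator_apply dT (hψ t ht)
    refine ⟨Λ t (c t) + (deriv T t (ψ t) + T t (-(Complex.I * (τ : ℂ)) • H t (ψ t))), ?_⟩
    refine ((hψ t ht).sub (hasDerivWithinAt_operator_apply (hV t) dc)).congr_deriv ?_
    have e1 : (H t * (P t + K t)) (c t) = H t ((P t + K t) (c t)) := rfl
    have e2 : ((P t + K t) * Λ t) (c t) = (P t + K t) (Λ t (c t)) := rfl
    rw [add_apply, add_apply,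
      neg_apply, smul_apply, e1, e2, hφ]
    simp only [map_sub, map_add (P t + K t), smul_sub, neg_smul]
    abel
  choose! v hv using hder
  have hφ0 : φ 0 = 0 := by
    simp only [hφ, hc, hT, hK0, add_zero, star_zero, zero_mul, Ring.inverse_one, one_mul, hPs,
      hPψ, sub_self]
  have hφn : ∀ t ∈ Icc (0 : ℝ) 1, ‖φ t‖ ≤ 4 := fun t ht => by
    refine (norm_sub_le _ _).trans ?_
    have h1 := ((P t + K t).le_opNorm (c t)).trans
      (mul_le_mul (hVn t) (hcn t ht) (norm_nonneg _) (by norm_num))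
    rw [hψn t ht]
    linarith
  have hE := norm_sq_le_of_energy hH (b := 16 * δ) hv (fun t ht => ?_) hs
  · refine ⟨c s, ?_⟩
    rw [hφ0, norm_zero, zero_pow two_ne_zero, sub_zero, abs_of_nonneg (by positivity)] at hE
    have h1 : ψ s - P s (c s) = φ s + K s (c s) := by
      simp only [hφ, add_apply]
      abel
    rw [h1]
    refine (norm_add_le _ _).trans (add_le_add (Real.le_sqrt_of_sq_le hE) ?_)
    refine ((K s).le_opNorm _).trans ?_
    rw [mul_comm]
    exact mul_le_mul (hcn s hs) (hK1 s) (norm_nonneg _) (by norm_num)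
  · rw [inner_sub_right, inner_neg_right, horth, neg_zero, zero_sub, map_neg, abs_neg]
    have h1 := (RCLike.abs_re_le_norm (inner ℂ (φ t) (r t (c t)))).trans (norm_inner_le_norm _ _)
    have h2 := ((r t).le_opNorm (c t)).trans
      (mul_le_mul (hr t) (hcn t ht) (norm_nonneg _) hδ)
    have h3 := mul_le_mul (hφn t ht) h2 (norm_nonneg _) (by norm_num)
    linarith

end Energy

/-! ### Switching families -/

section Switching

open SwitchingAdiabatic

variable {𝓗 : Type*} [NormedAddCommGroup 𝓗] [InnerProductSpace ℂ 𝓗] [CompleteSpace 𝓗]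
  {H : ℝ → 𝓗 →L[ℂ] 𝓗} {E : ℝ → ℝ} {g α R C : ℝ}

namespace SwitchingAdiabatic.IsSwitchingFamily

theorem deriv_eq_zero (h : IsSwitchingFamily H) {t : ℝ} (ht : t ∉ Icc (0 : ℝ) 1) :
    deriv H t = 0 :=
  image_eq_zero_of_notMem_tsupport fun hmem => ht (h.support_deriv hmem)

/-- The family is constant on both sides of `[0, 1]`. -/
theorem eq_projIcc (h : IsSwitchingFamily H) (t : ℝ) :
    H t = H (projIcc (0 : ℝ) 1 zero_le_one t) := by
  have hd : ∀ s, HasDerivAt H (deriv H s) s := fun s =>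
    (h.contDiff.differentiable (by simp)).differentiableAt.hasDerivAt
  have hcl : IsClosed {s | deriv H s = 0} :=
    isClosed_eq h.contDiff.deriv_infty.continuous continuous_const
  have hconst : ∀ D : Set ℝ, Convex ℝ D → (∀ s ∈ D, deriv H s = 0) →
      ∀ x ∈ D, ∀ y ∈ D, H x = H y := by
    intro D hD h0 x hx y hy
    have := hD.norm_image_sub_le_of_norm_hasDerivWithin_le (C := 0)
      (fun s _ => (hd s).hasDerivWithinAt) (fun s hs => by rw [h0 s hs, norm_zero]) hy hx
    rw [zero_mul] at this
    exact sub_eq_zero.1 (norm_le_zero_iff.1 this)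
  rcases le_total t 0 with ht | ht
  · rw [projIcc_of_le_left zero_le_one ht]
    have h0 : closure (Iio (0 : ℝ)) ⊆ {s | deriv H s = 0} :=
      hcl.closure_subset_iff.2 fun s hs => h.deriv_eq_zero fun hm => absurd hm.1 (not_le.2 hs)
    rw [closure_Iio] at h0
    exact hconst (Iic 0) (convex_Iic 0) h0 t ht 0 (mem_Iic.2 le_rfl)
  · rcases le_total t 1 with ht1 | ht1
    · rw [projIcc_of_mem zero_le_one ⟨ht, ht1⟩]
    · rw [projIcc_of_right_le zero_le_one ht1]
      have h0 : closure (Ioi (1 : ℝ)) ⊆ {s | deriv H s = 0} :=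
        hcl.closure_subset_iff.2 fun s hs => h.deriv_eq_zero fun hm => absurd hm.2 (not_le.2 hs)
      rw [closure_Ioi] at h0
      exact hconst (Ici 1) (convex_Ici 1) h0 t ht1 1 (mem_Ici.2 le_rfl)

/-- The eigenvalue is prolonged by constants outside `[0, 1]`, where `H` is constant, so that the
spectral data live on the whole line. -/
theorem exists_isGappedFamily (h : IsSwitchingFamily H) (hg : 0 < g)
    (hE : HasGappedEigenvalue H E g) :
    ∃ S, IsGappedFamily H
      (fun t => eigenprojector (H t) (E (projIcc (0 : ℝ) 1 zero_le_one t))) S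
      (fun t => E (projIcc (0 : ℝ) 1 zero_le_one t)) g := by
  have hr : ∀ t, ∃ r, IsIsolatedEigenvalue (H t)
      (eigenprojector (H t) (E (projIcc (0 : ℝ) 1 zero_le_one t))) r
      (E (projIcc (0 : ℝ) 1 zero_le_one t)) g := by
    intro t
    refine exists_isIsolatedEigenvalue (h.selfAdjoint t) hg ?_
    rw [h.eq_projIcc t]
    exact hE.gap _ (projIcc (0 : ℝ) 1 zero_le_one t).2
  choose S hS using hr
  refine ⟨S, h.contDiff, ?_, hg, hS, fun t => eigenprojector_ne_zero ?_⟩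
  · exact (continuousOn_iff_continuous_domRestrict.1 hE.continuousOn).comp continuous_projIcc
  · rw [h.eq_projIcc t]
    exact hE.hasEigenvalue _ (projIcc (0 : ℝ) 1 zero_le_one t).2

theorem jetNorm_deriv_le {ρ : ℝ} (h : IsSwitchingFamily H) (hG : GevreyBound α R C H)
    (hα : 1 ≤ α) (hR : 0 < R) (hρ : 0 < ρ) (hρR : ρ * R * 6 ^ α ≤ 1 / 2) (N : ℕ) (s : ℝ) :
    jetNorm (gevreyWeight α ρ) N (deriv H) s ≤ 2 * (|C| * R * 3 ^ α) := by
  by_cases hs : s ∈ Icc (0 : ℝ) 1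
  · refine jetNorm_deriv_le_of_gevrey (by linarith) hρ hR (abs_nonneg C) hρR
      (fun k hk => (hG k hk s hs).trans ?_) N
    gcongr
    exact le_abs_self C
  · have h0 : deriv H =ᶠ[nhds s] fun _ => 0 := by
      filter_upwards [isClosed_Icc.isOpen_compl.mem_nhds hs] with t ht using h.deriv_eq_zero ht
    have h1 : jetNorm (gevreyWeight α ρ) N (deriv H) s
        = jetNorm (gevreyWeight α ρ) N (fun _ => (0 : 𝓗 →L[ℂ] 𝓗)) s :=
      Finset.sum_congr rfl fun k _ => by rw [h0.iteratedDeriv_eq]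
    rw [h1, jetNorm_const (isJetWeight_gevreyWeight hα hρ), norm_zero]
    positivity

end SwitchingAdiabatic.IsSwitchingFamily

/-- The adiabatic error after `n + 1` iterations. The number `η` bounds the jets of `H'`, the cost
of a derivative is `d = 64 η (n + 1)^α / g`, and `θ` is the ratio of contraction. -/
theorem infDist_le_of_iteration {η τ θ d : ℝ} {ψ : ℝ → 𝓗} (h : IsSwitchingFamily H)
    (hG : GevreyBound α R C H) (hα : 1 ≤ α) (hR : 0 < R) (hg : 0 < g)
    (hE : HasGappedEigenvalue H E g) (hη : 0 < η) (hCη : 2 * (|C| * R * 3 ^ α) ≤ η)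
    (hgη : g / (64 * η) * R * 6 ^ α ≤ 1 / 2) (hτ : 0 < τ) (n : ℕ)
    (hd : d = 64 * η * ((n + 1 : ℕ) : ℝ) ^ α / g) (hθ : 8 * d / (τ * g) ≤ θ) (hθ4 : θ ≤ 1 / 4)
    (hψ : IsSchrodingerSolution H τ ψ) (hψ0 : ‖ψ 0‖ = 1)
    (hψP : ψ 0 ∈ range (eigenprojector (H 0) (E 0))) {s : ℝ} (hs : s ∈ Icc (0 : ℝ) 1) :
    Metric.infDist (ψ s) (range (eigenprojector (H s) (E s)))
      ≤ Real.sqrt (16 * (4 * d * θ ^ (n + 1))) + 4 * θ := by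
  obtain ⟨S, hS⟩ := h.exists_isGappedFamily hg hE
  set P : ℝ → 𝓗 →L[ℂ] 𝓗 :=
    fun t => eigenprojector (H t) (E (projIcc (0 : ℝ) 1 zero_le_one t)) with hPdef
  have hPs : ∀ t ∈ Icc (0 : ℝ) 1, P t = eigenprojector (H t) (E t) := by
    intro t ht
    simp only [hPdef]
    rw [projIcc_of_mem zero_le_one ht]
  set ρ := g / (64 * η) with hρ
  have hρ0 : 0 < ρ := by positivity
  have hα0 : 0 ≤ α := by linarith
  have hb : IsGappedFamily.HasJetBound H g (gevreyWeight α ρ) ρ η :=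
    { weight := isJetWeight_gevreyWeight hα hρ0
      weight_succ_le := gevreyWeight_succ_le hα0 hρ0
      rho_nonneg := hρ0.le
      eta_pos := hη
      jetNorm_deriv_le := fun N t => (h.jetNorm_deriv_le hG hα hR hρ0 hgη N t).trans hCη
      mul_le := by rw [hρ, mul_div_cancel₀ _ (by positivity)] }
  have hdρ : d = ((n + 1 : ℕ) : ℝ) ^ α / ρ := by
    rw [hd, hρ]
    field_simp
  have hdw : ∀ k < n + 1, gevreyWeight α ρ k ≤ d * gevreyWeight α ρ (k + 1) := fun k hk => by
    rw [hdρ]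
    exact gevreyWeight_le_succ hα0 hρ0 hk
  have hdη : 16 * η / g ≤ d := by
    have h1 : (1 : ℝ) ≤ ((n + 1 : ℕ) : ℝ) ^ α :=
      Real.one_le_rpow (by exact_mod_cast Nat.le_add_left 1 n) hα0
    rw [hd]
    refine div_le_div_of_nonneg_right ?_ hg.le
    nlinarith
  set κ : ℂ := Complex.I / τ with hκ
  have hκn : ‖κ‖ = 1 / τ := by
    rw [hκ, norm_div, Complex.norm_I, Complex.norm_real, Real.norm_of_nonneg hτ.le]
  have hθκ : 8 * d * ‖κ‖ / g ≤ θ := by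
    refine le_trans (le_of_eq ?_) hθ
    rw [hκn]
    field_simp
  have hzκ : Complex.I * (τ : ℂ) * κ = -1 := by
    have : (τ : ℂ) ≠ 0 := by exact_mod_cast hτ.ne'
    rw [hκ]
    field_simp
    exact Complex.I_sq
  have hV : ∀ t, HasDerivAt (fun u => P u + adiabaticGraph P S κ (n + 1) u)
      (-((Complex.I * (τ : ℂ)) • (H t * (P t + adiabaticGraph P S κ (n + 1) t)))
        + (P t + adiabaticGraph P S κ (n + 1) t) *
          ((Complex.I * (τ : ℂ)) • E (projIcc (0 : ℝ) 1 zero_le_one t) • (1 : 𝓗 →L[ℂ] 𝓗)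
            + deriv P t * (1 - P t - adiabaticGraph P S κ (n + 1) t))
        + (1 - P t) * (graphTerm P (adiabaticGraph P S κ (n + 1)) t
            - graphTerm P (adiabaticGraph P S κ n) t) * P t) t := by
    intro t
    refine (hS.hasDerivAt_proj_add (hS.contDiff_adiabaticGraph κ (n + 1))
      (hS.isOffDiagonal_adiabaticGraph κ (n + 1)) (Complex.I * τ) t).congr_deriv ?_
    rw [hS.commutator_adiabaticGraph_succ, smul_smul, hzκ, neg_one_smul,
      ← sub_eq_add_neg, ← sub_mul, ← mul_sub]
  have h0 : (0 : ℝ) ∈ Icc (0 : ℝ) 1 := ⟨le_rfl, zero_le_one⟩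
  have hP0 : P 0 (ψ 0) = ψ 0 := by
    obtain ⟨v, hv⟩ := hψP
    rw [← hPs 0 h0] at hv
    rw [← hv]
    exact DFunLike.congr_fun (hS.isolated 0).mul_self v
  obtain ⟨c, hc⟩ := norm_sub_projection_le h.selfAdjoint hS.contDiff_proj
    (hS.contDiff_adiabaticGraph κ (n + 1)) (fun t => (hS.isolated t).mul_self)
    (fun t => (hS.isolated t).selfAdjoint) (fun t => (hS.isolated t).norm_le)
    (hS.isOffDiagonal_adiabaticGraph κ (n + 1)) (κ := 2 * θ) (by linarith)
    (hS.norm_adiabaticGraph_le hb hdw hdη hθκ (by linarith)) hV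
    (hS.norm_graphDefect_le hb hdw hdη hθκ (by linarith)) hψ hψ0 hP0
    (hS.adiabaticGraph_eq_zero (fun t ht => h.deriv_eq_zero fun hm => absurd hm.1 (not_le.2 ht))
      κ (n + 1)) hs
  rw [← hPs s hs]
  refine (Metric.infDist_le_dist_of_mem (mem_range_self c)).trans ?_
  rw [dist_eq_norm]
  refine hc.trans (le_of_eq ?_)
  ring

end Switching

/-! ### Choice of the order of the expansion -/

section Asymptotics

open Filter Topology

/-- For a gap `exp (-L)` and `n ≈ L` iterations, the quantities that control the error are small
for large `L`. -/
theorem eventually_error_bounds {α η R ε : ℝ} (hα : 0 < α) (hε : 0 < ε) :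
    ∀ᶠ L : ℝ in atTop, 1 ≤ L ∧ Real.exp (-L) / (64 * η) * R * 6 ^ α ≤ 1 / 2 ∧
      512 * η * 3 ^ α * L ^ (-(5 * α)) ≤ Real.exp (-2) ∧
      Real.sqrt (16 * (256 * η * 3 ^ α * (L ^ α * Real.exp (-1 * L))))
        + 4 * (512 * η * 3 ^ α * L ^ (-(5 * α))) < ε := by
  have t1 : Tendsto (fun L : ℝ => Real.exp (-L) / (64 * η) * R * 6 ^ α) atTop (𝓝 0) := by
    simpa using (((Real.tendsto_exp_neg_atTop_nhds_zero).div_const (64 * η)).mul_const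
      R).mul_const ((6 : ℝ) ^ α)
  have t2 : Tendsto (fun L : ℝ => 512 * η * 3 ^ α * L ^ (-(5 * α))) atTop (𝓝 0) := by
    simpa using (tendsto_rpow_neg_atTop (show 0 < 5 * α by positivity)).const_mul
      (512 * η * (3 : ℝ) ^ α)
  have t3 : Tendsto (fun L : ℝ => Real.sqrt (16 * (256 * η * 3 ^ α * (L ^ α * Real.exp (-1 * L))))
      + 4 * (512 * η * 3 ^ α * L ^ (-(5 * α)))) atTop (𝓝 0) := by
    have h1 := (((tendsto_rpow_mul_exp_neg_mul_atTop_nhds_zero α 1 one_pos).const_mul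
      (256 * η * (3 : ℝ) ^ α)).const_mul 16).sqrt
    simpa using h1.add (t2.const_mul 4)
  filter_upwards [eventually_ge_atTop 1, t1.eventually_le_const (by norm_num : (0 : ℝ) < 1 / 2),
    t2.eventually_le_const (Real.exp_pos (-2)), t3.eventually_lt_const hε] with L h1 h2 h3 h4
  exact ⟨h1, h2, h3, h4⟩

end Asymptotics

theorem theorem1 (α R C : ℝ) (hα : 1 < α) (hR : 0 < R) :
    ∃ K : ℝ, 0 < K ∧ ∀ ε : ℝ, 0 < ε → ∃ g₀ : ℝ, 0 < g₀ ∧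
      ∀ (𝓗 : Type*) [NormedAddCommGroup 𝓗] [InnerProductSpace ℂ 𝓗] [CompleteSpace 𝓗]
        (H : ℝ → 𝓗 →L[ℂ] 𝓗) (E : ℝ → ℝ) (g τ : ℝ) (ψ : ℝ → 𝓗),
        SwitchingAdiabatic.IsSwitchingFamily H →
        SwitchingAdiabatic.GevreyBound α R C H →
        0 < g → g < g₀ →
        SwitchingAdiabatic.HasGappedEigenvalue H E g →
        K * g ^ (-2 : ℤ) * |Real.log g| ^ (6 * α) ≤ τ →
        SwitchingAdiabatic.IsSchrodingerSolution H τ ψ →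
        ‖ψ 0‖ = 1 →
        ψ 0 ∈ Set.range (SwitchingAdiabatic.eigenprojector (H 0) (E 0)) →
        ∀ s ∈ Set.Icc (0 : ℝ) 1,
          Metric.infDist (ψ s)
            (Set.range (SwitchingAdiabatic.eigenprojector (H s) (E s))) < ε := by
  -- the contraction ratio is of order `n^α / (g² τ)` with `n ≈ |ln g|`; as the exponent `6 α` exceeds
  -- `α`, it is small for small `g` whatever the value of `K`
  refine ⟨1, one_pos, fun ε hε => ?_⟩
  have hα0 : 0 < α := by linarith
  set η : ℝ := 2 * (|C| * R * 3 ^ α) + 1 with hη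
  have hη0 : 0 < η := by positivity
  obtain ⟨L₀, hL₀⟩ := Filter.eventually_atTop.1
    (eventually_error_bounds (η := η) (R := R) hα0 hε)
  refine ⟨Real.exp (-L₀), Real.exp_pos _, ?_⟩
  intro 𝓗 _ _ _ H E g τ ψ hH hG hg hgL hE hτ hψ hψ0 hψP s hs
  set L := -Real.log g with hL
  have hgexp : g = Real.exp (-L) := by rw [hL, neg_neg, Real.exp_log hg]
  have hLL : L₀ ≤ L := by
    rw [hgexp, Real.exp_lt_exp] at hgL
    linarith
  obtain ⟨h1, h2, h3, h4⟩ := hL₀ L hLL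
  have hL0 : 0 < L := by linarith
  rw [one_mul, show |Real.log g| = L by rw [← abs_neg, ← hL, abs_of_pos hL0]] at hτ
  have hLτ : L ^ (6 * α) ≤ τ * g ^ 2 := by
    rw [zpow_neg, ← div_eq_inv_mul, div_le_iff₀ (by positivity)] at hτ
    exact_mod_cast hτ
  have hτ0 : 0 < τ := by
    have : 0 < τ * g ^ 2 := lt_of_lt_of_le (by positivity) hLτ
    exact pos_of_mul_pos_left this (by positivity)
  set n := ⌈L⌉₊ with hn
  have hnL : L ≤ n := Nat.le_ceil L
  have hn3 : ((n + 1 : ℕ) : ℝ) ≤ 3 * L := by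
    have := Nat.ceil_lt_add_one hL0.le
    push_cast
    linarith
  have hnα : ((n + 1 : ℕ) : ℝ) ^ α ≤ 3 ^ α * L ^ α := by
    rw [← Real.mul_rpow (by norm_num) hL0.le]
    exact Real.rpow_le_rpow (by positivity) hn3 hα0.le
  set θ : ℝ := 512 * η * 3 ^ α * L ^ (-(5 * α)) with hθ
  have hθ0 : 0 ≤ θ := by positivity
  set d : ℝ := 64 * η * ((n + 1 : ℕ) : ℝ) ^ α / g with hd
  have hdθ : 8 * d / (τ * g) ≤ θ := by
    have e1 : 8 * d / (τ * g) = 512 * η * ((n + 1 : ℕ) : ℝ) ^ α / (τ * g ^ 2) := by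
      rw [hd]
      field_simp
      ring
    have e2 : L ^ (-(5 * α)) = L ^ α / L ^ (6 * α) := by
      rw [← Real.rpow_sub hL0]
      congr 1
      ring
    rw [e1, hθ, e2, ← mul_div_assoc, mul_assoc _ ((3 : ℝ) ^ α)]
    gcongr
  have hexp : Real.exp (-2) ≤ 1 / 4 := by
    rw [Real.exp_neg, one_div]
    refine inv_anti₀ (by norm_num) ?_
    have := Real.add_one_le_exp (1 : ℝ)
    rw [show (2 : ℝ) = 1 + 1 by norm_num, Real.exp_add]
    nlinarith
  have hpow : d * θ ^ (n + 1) ≤ 64 * η * 3 ^ α * (L ^ α * Real.exp (-1 * L)) := by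
    have p1 : θ ^ (n + 1) ≤ g * Real.exp (-1 * L) := by
      calc θ ^ (n + 1) ≤ Real.exp (-2) ^ (n + 1) := by gcongr
        _ = Real.exp (((n + 1 : ℕ) : ℝ) * (-2)) := (Real.exp_nat_mul _ _).symm
        _ ≤ Real.exp (-L + -1 * L) := by
            refine Real.exp_le_exp.2 ?_
            push_cast
            linarith
        _ = _ := by rw [Real.exp_add, ← hgexp]
    calc d * θ ^ (n + 1)
        ≤ (64 * η * (3 ^ α * L ^ α) / g) * (g * Real.exp (-1 * L)) := by
          rw [hd]
          gcongr
      _ = _ := by field_simp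
  have hmain := infDist_le_of_iteration hH hG hα.le hR hg hE hη0 (by rw [hη]; linarith)
    (by rw [hgexp]; exact h2) hτ0 n hd hdθ (h3.trans hexp) hψ hψ0 hψP hs
  refine hmain.trans_lt (lt_of_le_of_lt ?_ h4)
  refine add_le_add (Real.sqrt_le_sqrt ?_) le_rfl
  linarith
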